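/- **Theorem (Average representation error).** Let $N\ge 1$ be an integer and $W\in(0,\tfrac12)$. For $f\in\mathbb{R}$ let $\mathbf e_f=(e^{2\pi i f n})_{n=0}^{N-1}\in\mathbb{C}^N$. Let $\mathbf B_{N,W}\in\mathbb{C}^{N\times N}$ be the prolate matrix with entries $\mathbf B_{N,W}[m,n]=\frac{\sin(2\pi W(m-n))}{\pi(m-n)}$ for $m\ne n$ and $\mathbf B_{N,W}[m,m]=2W$. Let $\mathbf F_{N,W}$ be the $N\times(2\lfloor NW\rfloor+1)$ matrix with columns $\frac1{\sqrt N}\mathbf e_{k/N}$, $k=-\lfloor NW\rfloor,\dots,\lfloor NW\rfloor$, let $M=N-2\lfloor NW\rfloor-1\ge 0$, and let $\overline{\mathbf F}_{N,W}$ be the $N\times M$ matrix whose columns are the remaining normalized DFT vectors $\frac1{\sqrt N}\mathbf e_{k/N}$, $k=\lfloor NW\rfloor+1,\dots,N-\lfloor NW\rfloor-1$. Put $C_N=\frac{4}{\pi^2}\log(8N)+6$. For $\epsilon\in(0,\tfrac12)$ set $$R=\max\left\{\left\lceil C_N\log\left(\frac{15\,C_N}{N\epsilon}\right)\right\rceil+1,\;0\right\},\qquad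 r=\min\{R,M\}.$$ Let $\mathbf V\in\mathbb{C}^{M\times r}$ consist of $r$ dominant left singular vectors of $\overline{\mathbf F}_{N,W}^*\mathbf B_{N,W}$, that is, of the first $r$ columns of $\mathbf U$ in some singular value decomposition $\overline{\mathbf F}_{N,W}^*\mathbf B_{N,W}=\mathbf U\mathbf\Sigma\mathbf X^*$ with singular values in nonincreasing order. Then the columns of $\mathbf Q=[\mathbf F_{N,W}\;\;\overline{\mathbf F}_{N,W}\mathbf V]$ are orthonormal, and $$\int_{-W}^{W}\frac{\|\mathbf e_f-\mathbf Q\mathbf Q^*\mathbf e_f\|_2^2}{\|\mathbf e_f\|_2^2}\,df\le\epsilon .$$ -/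

import Mathlib

open scoped Matrix

noncomputable section

namespace Roast

/-- The sampled complex exponential `e_f = (e^{2π i f n})_{0 ≤ n < N}`. -/
def sinusoid (N : ℕ) (f : ℝ) : Fin N → ℂ :=
  fun n => Complex.exp (2 * Real.pi * Complex.I * f * ((n : ℕ) : ℂ))

/-- The Euclidean norm of a complex vector. -/
def norm2 {N : ℕ} (x : Fin N → ℂ) : ℝ := ‖WithLp.toLp 2 x‖

/-- The prolate matrix, with entries `sin (2πW(m-n)) / (π(m-n))`, and `2W` on the diagonal. -/
def prolate (N : ℕ) (W : ℝ) : Matrix (Fin N) (Fin N) ℂ :=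
  Matrix.of fun m n =>
    if m = n then ((2 * W : ℝ) : ℂ)
    else ((Real.sin (2 * Real.pi * W * (((m : ℕ) : ℝ) - ((n : ℕ) : ℝ))) /
      (Real.pi * (((m : ℕ) : ℝ) - ((n : ℕ) : ℝ))) : ℝ) : ℂ)

/-- `⌊N W⌋`. -/
def halfBand (N : ℕ) (W : ℝ) : ℕ := ⌊(N : ℝ) * W⌋₊

/-- The number `2⌊NW⌋ + 1` of low frequency DFT vectors. -/
abbrev numLow (N : ℕ) (W : ℝ) : ℕ := 2 * halfBand N W + 1

/-- The number `N - 2⌊NW⌋ - 1` of remaining, high frequency DFT vectors. For `N ≥ 1` and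
`0 < W < 1/2` one has `2⌊NW⌋ + 1 ≤ N`, so that the subtraction does not truncate. -/
abbrev numHigh (N : ℕ) (W : ℝ) : ℕ := N - numLow N W

/-- The partial normalized DFT matrix whose columns are `e_{k/N} / √N`,
`k = -⌊NW⌋, …, ⌊NW⌋`. -/
def lowDFT (N : ℕ) (W : ℝ) : Matrix (Fin N) (Fin (numLow N W)) ℂ :=
  Matrix.of fun n j =>
    ((1 / Real.sqrt N : ℝ) : ℂ) *
      sinusoid N ((((j : ℕ) : ℝ) - (halfBand N W : ℝ)) / N) n

/-- The partial normalized DFT matrix of the remaining frequencies: its columns are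
`e_{k/N} / √N`, `k = ⌊NW⌋ + 1, …, N - ⌊NW⌋ - 1` (`e_f` has period `1` in `f`). -/
def highDFT (N : ℕ) (W : ℝ) : Matrix (Fin N) (Fin (numHigh N W)) ℂ :=
  Matrix.of fun n j =>
    ((1 / Real.sqrt N : ℝ) : ℂ) *
      sinusoid N (((halfBand N W : ℝ) + 1 + ((j : ℕ) : ℝ)) / N) n

/-- A (thin) singular value decomposition `A = U diag(s) Xᴴ` of a matrix with `M ≤ N` rows and
`N` columns: `U` is unitary, the columns of `X` are orthonormal, and the singular values
`s 0 ≥ s 1 ≥ ⋯` are nonnegative and listed in nonincreasing order. -/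
structure IsSVD {M N : ℕ} (A : Matrix (Fin M) (Fin N) ℂ) (U : Matrix (Fin M) (Fin M) ℂ)
    (s : Fin M → ℝ) (X : Matrix (Fin N) (Fin M) ℂ) : Prop where
  left_unitary : U ∈ Matrix.unitaryGroup (Fin M) ℂ
  right_orthonormal : Xᴴ * X = 1
  nonneg : ∀ i, 0 ≤ s i
  antitone : Antitone s
  eq : A = U * Matrix.diagonal (fun i => (s i : ℂ)) * Xᴴ

/-- The columns of `V` are `r` dominant left singular vectors of `A`, i.e. the first `r` left
singular vectors of some singular value decomposition of `A`. -/
def IsDominantLeft {M N r : ℕ} (A : Matrix (Fin M) (Fin N) ℂ) (V : Matrix (Fin M) (Fin r) ℂ) :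
    Prop :=
  ∃ (U : Matrix (Fin M) (Fin M) ℂ) (s : Fin M → ℝ) (X : Matrix (Fin N) (Fin M) ℂ),
    IsSVD A U s X ∧ ∃ hr : r ≤ M, V = U.submatrix id (Fin.castLE hr)

/-- The matrix `Q = [F  F̄ V]`. -/
def basis (N : ℕ) (W : ℝ) {r : ℕ} (V : Matrix (Fin (numHigh N W)) (Fin r) ℂ) :
    Matrix (Fin N) (Fin (numLow N W) ⊕ Fin r) ℂ :=
  Matrix.fromCols (lowDFT N W) (highDFT N W * V)

/-- `C_N = (4/π²) log(8N) + 6`. -/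
def constC (N : ℕ) : ℝ := 4 / Real.pi ^ 2 * Real.log (8 * N) + 6

/-- `R = max {⌈C_N log(15 C_N / (N ε))⌉ + 1, 0}`. -/
def numR (N : ℕ) (ε : ℝ) : ℕ :=
  (max (⌈constC N * Real.log (15 * constC N / (N * ε))⌉ + 1) 0).toNat

end Roast

end

/-! Write `A` for F̄*B, with singular triples s_i, u_i, x_i, and put g_i = F̄ u_i. Since `[F F̄]` is
unitary, the residual of e_f is its component along the g_i with i ≥ r. The prolate matrix is the
moment matrix of the band, so the energy of e_f along g_i, integrated over the band, is g_i*B g_i =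
s_i Re⟨x_i, g_i⟩ ≤ s_i (`integral_norm_sq_leftSingular_le`). It remains to bound the tail of the
singular values by Nε, which follows from s_i ≤ 15 exp(-i/C_N) (`singularValue_le_exp`).

The decay comes from explicit low-rank approximations. Summing a geometric series shows that the
kernel of `A` is a(f) b(k) / sin(π(y_k - f)), and a Möbius change of variable turns it into a Cauchy
kernel 1/(w(f) + v_k) with w, v in [1/N, N]. The two frequencies nearest the band are set aside at
the cost of rank 2. For Φ(x) = ∏ (x - p_j)/(x + p_j), replacing the kernel K by Φ(w)Φ(v)K changes
the matrix by one unit of rank per factor (`rank_dampedMatrix_sub_le`), while the damped matrix has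
norm at most (sup |Φ|)² (`re_dampedMatrix_le`). With the shifts 9^j/N, a cycle of about log N
factors makes |Φ| four times smaller on [1/N, N], so each cycle gains a factor 16
(`singularValue_le_pow`). -/

namespace Roast

/-! ### Linear algebra: isometries, rank and singular values. -/

section LinearAlgebra

variable {ι κ : Type*}

lemma star_dotProduct_self [Fintype ι] (x : ι → ℂ) : star x ⬝ᵥ x = ((∑ i, ‖x i‖ ^ 2 : ℝ) : ℂ) := by
  simp [dotProduct, ← Complex.conj_mul']

lemma star_mulVec_dotProduct [Fintype ι] [Fintype κ] (M : Matrix ι κ ℂ) (x : κ → ℂ) (y : ι → ℂ) :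
    star (M *ᵥ x) ⬝ᵥ y = star x ⬝ᵥ Mᴴ *ᵥ y := by
  rw [Matrix.star_mulVec, Matrix.dotProduct_mulVec]

/-- A matrix with orthonormal columns preserves the Euclidean norm. -/
lemma sum_norm_sq_mulVec [Fintype ι] [Fintype κ] [DecidableEq κ] {M : Matrix ι κ ℂ}
    (hM : Mᴴ * M = 1) (x : κ → ℂ) :
    ∑ i, ‖(M *ᵥ x) i‖ ^ 2 = ∑ i, ‖x i‖ ^ 2 := by
  apply Complex.ofReal_injective
  rw [← star_dotProduct_self, ← star_dotProduct_self, star_mulVec_dotProduct,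
    Matrix.mulVec_mulVec, hM, Matrix.one_mulVec]

lemma re_star_dotProduct_le [Fintype ι] (x y : ι → ℂ) :
    (star x ⬝ᵥ y).re ≤ ((∑ i, ‖x i‖ ^ 2) + ∑ i, ‖y i‖ ^ 2) / 2 := by
  refine (Complex.re_le_norm _).trans ?_
  calc ‖star x ⬝ᵥ y‖ ≤ ∑ i, ‖star x i * y i‖ := norm_sum_le _ _
    _ ≤ ∑ i, (‖x i‖ ^ 2 + ‖y i‖ ^ 2) / 2 := by
        refine Finset.sum_le_sum fun i _ => ?_
        rw [norm_mul, Pi.star_apply, norm_star]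
        nlinarith [sq_nonneg (‖x i‖ - ‖y i‖)]
    _ = _ := by rw [← Finset.sum_div, Finset.sum_add_distrib]

lemma conjTranspose_submatrix_mul_self {τ : Type*} [Fintype ι] [DecidableEq κ] [DecidableEq τ]
    {M : Matrix ι κ ℂ} (hM : Mᴴ * M = 1) {g : τ → κ} (hg : Function.Injective g) :
    (M.submatrix id g)ᴴ * M.submatrix id g = 1 := by
  rw [Matrix.conjTranspose_submatrix, ← Matrix.submatrix_mul _ _ _ _ _ Function.bijective_id, hM,
    Matrix.submatrix_one _ hg]

lemma exists_ne_zero_mulVec_eq_zero_of_rank_lt [Fintype κ] {M : Matrix ι κ ℂ}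
    (h : M.rank < Fintype.card κ) : ∃ x ≠ 0, M *ᵥ x = 0 := by
  have h1 := LinearMap.finrank_range_add_finrank_ker M.mulVecLin
  have h2 : LinearMap.ker M.mulVecLin ≠ ⊥ := by
    intro hb
    rw [hb, finrank_bot, Module.finrank_fintype_fun_eq_card] at h1
    rw [Matrix.rank] at h
    omega
  obtain ⟨x, hx, hx0⟩ := Submodule.exists_mem_ne_zero_of_ne_bot h2
  exact ⟨x, hx0, by simpa using hx⟩

end LinearAlgebra

/-- A singular value is at most the distance to a matrix of small rank. -/
lemma IsSVD.singularValue_le {M N : ℕ} {A : Matrix (Fin M) (Fin N) ℂ}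
    {U : Matrix (Fin M) (Fin M) ℂ} {s : Fin M → ℝ} {X : Matrix (Fin N) (Fin M) ℂ}
    (hA : IsSVD A U s X) (i : Fin M) {L : Matrix (Fin M) (Fin N) ℂ} (hL : L.rank ≤ i) {c : ℝ}
    (h : ∀ α β, (star α ⬝ᵥ (A - L) *ᵥ β).re ≤ c * (((∑ i, ‖α i‖ ^ 2) + ∑ i, ‖β i‖ ^ 2) / 2)) :
    s i ≤ c := by
  have hi : (i : ℕ) + 1 ≤ M := i.2
  set g : Fin (i + 1) → Fin M := Fin.castLE hi with hg
  have hginj : Function.Injective g := Fin.castLE_injective hi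
  have hU : Uᴴ * U = 1 := Matrix.mem_unitaryGroup_iff'.1 hA.left_unitary
  set C := X.submatrix id g with hC
  set D := U.submatrix id g with hD
  have hCC : Cᴴ * C = 1 := conjTranspose_submatrix_mul_self hA.right_orthonormal hginj
  have hDD : Dᴴ * D = 1 := conjTranspose_submatrix_mul_self hU hginj
  have hDAC : Dᴴ * A * C = Matrix.diagonal fun j => (s (g j) : ℂ) := by
    have h1 : Uᴴ * A * X = Matrix.diagonal fun j => (s j : ℂ) := by
      rw [hA.eq, Matrix.mul_assoc U, ← Matrix.mul_assoc Uᴴ, hU, Matrix.one_mul, Matrix.mul_assoc,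
        hA.right_orthonormal, Matrix.mul_one]
    have h2 : Dᴴ * A * C = (Uᴴ * A * X).submatrix g g := by
      rw [Matrix.submatrix_mul _ _ _ _ _ Function.bijective_id,
        Matrix.submatrix_mul _ _ _ _ _ Function.bijective_id, Matrix.submatrix_id_id]
      rfl
    rw [h2, h1, Matrix.submatrix_diagonal _ _ hginj]
    rfl
  -- `L * C` has i + 1 columns and rank at most i, so some combination of the top i + 1 right
  -- singular vectors is killed by `L`, whereas `A` stretches it by at least `s i`.
  obtain ⟨δ, hδ0, hδ⟩ := exists_ne_zero_mulVec_eq_zero_of_rank_lt (M := L * C) (by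
    rw [Fintype.card_fin]
    exact Nat.lt_succ_of_le ((Matrix.rank_mul_le_left _ _).trans hL))
  have hpos : 0 < ∑ j, ‖δ j‖ ^ 2 := by
    obtain ⟨j, hj⟩ := Function.ne_iff.1 hδ0
    exact Finset.sum_pos' (fun _ _ => by positivity)
      ⟨j, Finset.mem_univ _, by have := norm_pos_iff.2 hj; positivity⟩
  -- The two test vectors have equal norm, so the arithmetic mean in `h` loses nothing against a
  -- product of norms.
  have key := h (D *ᵥ δ) (C *ᵥ δ)
  rw [sum_norm_sq_mulVec hCC, sum_norm_sq_mulVec hDD, add_self_div_two, Matrix.sub_mulVec,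
    Matrix.mulVec_mulVec δ L, hδ, sub_zero, star_mulVec_dotProduct, Matrix.mulVec_mulVec,
    Matrix.mulVec_mulVec, hDAC] at key
  have h3 : (star δ ⬝ᵥ (Matrix.diagonal fun j => (s (g j) : ℂ)) *ᵥ δ).re
      = ∑ j, s (g j) * ‖δ j‖ ^ 2 := by
    have : star δ ⬝ᵥ (Matrix.diagonal fun j => (s (g j) : ℂ)) *ᵥ δ
        = ((∑ j, s (g j) * ‖δ j‖ ^ 2 : ℝ) : ℂ) := by
      simp only [dotProduct, Matrix.mulVec_diagonal, Pi.star_apply, Complex.ofReal_sum,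
        Complex.ofReal_mul, Complex.ofReal_pow, ← Complex.conj_mul', RCLike.star_def]
      exact Finset.sum_congr rfl fun j _ => by ring
    rw [this, Complex.ofReal_re]
  rw [h3] at key
  have h4 : s i * ∑ j, ‖δ j‖ ^ 2 ≤ ∑ j, s (g j) * ‖δ j‖ ^ 2 := by
    rw [Finset.mul_sum]
    refine Finset.sum_le_sum fun j _ => mul_le_mul_of_nonneg_right (hA.antitone ?_) (by positivity)
    rw [Fin.le_def, hg, Fin.val_castLE]
    omega
  exact le_of_mul_le_mul_right (h4.trans key) hpos

/-! ### Sampled exponentials and the prolate matrix as a moment matrix. -/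

lemma sinusoid_continuous (N : ℕ) (n : Fin N) : Continuous fun f => sinusoid N f n := by
  unfold sinusoid; fun_prop

lemma star_sinusoid (N : ℕ) (f : ℝ) (n : Fin N) :
    star (sinusoid N f n) = Complex.exp (-(2 * Real.pi * Complex.I * f * ((n : ℕ) : ℂ))) := by
  rw [sinusoid, RCLike.star_def, ← Complex.exp_conj]
  simp [Complex.conj_ofNat]

lemma norm_sinusoid (N : ℕ) (f : ℝ) (n : Fin N) : ‖sinusoid N f n‖ = 1 := by
  have : (2 * Real.pi * Complex.I * f * ((n : ℕ) : ℂ)) =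
      ((2 * Real.pi * f * (n : ℕ) : ℝ) : ℂ) * Complex.I := by push_cast; ring
  rw [sinusoid, this, Complex.norm_exp_ofReal_mul_I]

lemma norm2_sq {N : ℕ} (x : Fin N → ℂ) : norm2 x ^ 2 = ∑ n, ‖x n‖ ^ 2 := by
  rw [norm2, EuclideanSpace.norm_sq_eq]

lemma norm2_sinusoid_sq (N : ℕ) (f : ℝ) : norm2 (sinusoid N f) ^ 2 = N := by
  simp [norm2_sq, norm_sinusoid]

/-- The entries of the prolate matrix are the moments of the band `[-W, W]`. -/
lemma integral_sinusoid_mul_star (N : ℕ) (W : ℝ) (m n : Fin N) :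
    ∫ f in (-W)..W, sinusoid N f m * star (sinusoid N f n) = prolate N W m n := by
  simp only [star_sinusoid]
  simp only [sinusoid, ← Complex.exp_add, prolate, Matrix.of_apply]
  split_ifs with h
  · subst h
    simp
    ring
  · have hmn : (((m : ℕ) : ℝ) - ((n : ℕ) : ℝ)) ≠ 0 := by
      rw [sub_ne_zero]
      exact fun h' => h (Fin.ext (by exact_mod_cast h'))
    set d : ℝ := ((m : ℕ) : ℝ) - ((n : ℕ) : ℝ) with hd
    have hc : (2 * Real.pi * d : ℂ) * Complex.I ≠ 0 := by
      have := Real.pi_ne_zero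
      simp [this, hmn]
    have he : ∀ f : ℝ, (2 * Real.pi * Complex.I * f * ((m : ℕ) : ℂ)) +
        -(2 * Real.pi * Complex.I * f * ((n : ℕ) : ℂ)) = (2 * Real.pi * d : ℂ) * Complex.I * f := by
      intro f; rw [hd]; push_cast; ring
    simp_rw [he]
    rw [integral_exp_mul_complex hc]
    have hpi : (Real.pi : ℂ) ≠ 0 := by exact_mod_cast Real.pi_ne_zero
    have hdc : (d : ℂ) ≠ 0 := by exact_mod_cast hmn
    push_cast
    rw [show (2 * Real.pi * d : ℂ) * Complex.I * W = (2 * Real.pi * W * d : ℂ) * Complex.I by ring,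
      show (2 * Real.pi * d : ℂ) * Complex.I * -W = -(2 * Real.pi * W * d : ℂ) * Complex.I by ring,
      Complex.exp_mul_I, Complex.exp_mul_I, Complex.cos_neg, Complex.sin_neg]
    field_simp
    ring

lemma prolate_half (N : ℕ) : prolate N (1 / 2) = 1 := by
  ext m n
  rw [prolate, Matrix.of_apply, Matrix.one_apply]
  split_ifs with h
  · norm_num
  · have : Real.sin (2 * Real.pi * (1 / 2) * (((m : ℕ) : ℝ) - ((n : ℕ) : ℝ))) = 0 := by
      rw [Real.sin_eq_zero_iff]
      exact ⟨(m : ℕ) - (n : ℕ), by push_cast; ring⟩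
    rw [this]; simp

lemma star_dotProduct_sinusoid_continuous {N : ℕ} (α : Fin N → ℂ) :
    Continuous fun f => star α ⬝ᵥ sinusoid N f := by
  unfold dotProduct
  exact continuous_finsetSum _ fun n _ => continuous_const.mul (sinusoid_continuous N n)

lemma star_dotProduct_prolate_mulVec {N : ℕ} (W : ℝ) (α : Fin N → ℂ) :
    star α ⬝ᵥ prolate N W *ᵥ α =
      ((∫ f in (-W)..W, ‖star α ⬝ᵥ sinusoid N f‖ ^ 2 : ℝ) : ℂ) := by
  have h1 : ∀ f : ℝ, ((‖star α ⬝ᵥ sinusoid N f‖ ^ 2 : ℝ) : ℂ) =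
      ∑ m, ∑ n, star (α m) * (sinusoid N f m * star (sinusoid N f n)) * α n := by
    intro f
    rw [Complex.ofReal_pow, ← Complex.mul_conj']
    simp only [dotProduct, map_sum, Finset.sum_mul_sum, Pi.star_apply, map_mul, RCLike.star_def,
      Complex.conj_conj]
    exact Finset.sum_congr rfl fun m _ => Finset.sum_congr rfl fun n _ => by ring
  have hcont : ∀ m n : Fin N, Continuous fun f : ℝ =>
      star (α m) * (sinusoid N f m * star (sinusoid N f n)) * α n := fun m n =>
    (continuous_const.mul ((sinusoid_continuous N m).mul
      (sinusoid_continuous N n).star)).mul continuous_const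
  rw [← intervalIntegral.integral_ofReal]
  simp_rw [h1]
  rw [intervalIntegral.integral_finsetSum fun m _ =>
    (continuous_finsetSum _ fun n _ => hcont m n).intervalIntegrable _ _]
  simp only [dotProduct, Matrix.mulVec, Pi.star_apply]
  refine Finset.sum_congr rfl fun m _ => ?_
  rw [intervalIntegral.integral_finsetSum fun n _ => (hcont m n).intervalIntegrable _ _,
    Finset.mul_sum]
  refine Finset.sum_congr rfl fun n _ => ?_
  rw [intervalIntegral.integral_mul_const, intervalIntegral.integral_const_mul,
    integral_sinusoid_mul_star]
  ring

/-! ### Orthonormality and completeness of the DFT vectors. -/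

lemma sum_star_sinusoid_mul_sinusoid {N : ℕ} (hN : 0 < N) {a b : ℤ} (hab : |b - a| < N) :
    ∑ n, star (sinusoid N (a / N) n) * sinusoid N (b / N) n = if a = b then (N : ℂ) else 0 := by
  have hNc : (N : ℂ) ≠ 0 := by exact_mod_cast hN.ne'
  set z := Complex.exp (2 * Real.pi * Complex.I * ((b - a : ℤ) : ℂ) / N) with hz
  have hterm : ∀ n : Fin N, star (sinusoid N (a / N) n) * sinusoid N (b / N) n = z ^ (n : ℕ) := by
    intro n
    rw [star_sinusoid, sinusoid, ← Complex.exp_add, hz, ← Complex.exp_nat_mul]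
    congr 1
    push_cast
    ring
  simp_rw [hterm]
  rw [Fin.sum_univ_eq_sum_range fun n => z ^ n]
  split_ifs with h
  · have : z = 1 := by rw [hz, h]; simp
    simp [this]
  · have hz1 : z ≠ 1 := by
      rw [hz, Ne, Complex.exp_eq_one_iff]
      rintro ⟨n, hn⟩
      have h2 : ((b - a : ℤ) : ℂ) = ((n * N : ℤ) : ℂ) := by
        have := Complex.two_pi_I_ne_zero
        field_simp at hn
        push_cast at hn ⊢
        linear_combination hn
      have h3 : b - a = n * N := by exact_mod_cast h2
      have h4 := Int.eq_zero_of_abs_lt_dvd ⟨n, by rw [h3]; ring⟩ hab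
      omega
    have hzN : z ^ N = 1 := by
      rw [hz, ← Complex.exp_nat_mul, Complex.exp_eq_one_iff]
      exact ⟨b - a, by field_simp⟩
    have := geom_sum_mul z N
    rw [hzN, sub_self] at this
    exact (mul_eq_zero.1 this).resolve_right (sub_ne_zero.2 hz1)

/-- The integer frequencies of the columns of `[F  F̄]`. -/
noncomputable def dftFreq (N : ℕ) (W : ℝ) : Fin (numLow N W) ⊕ Fin (numHigh N W) → ℤ :=
  Sum.elim (fun j => (j : ℕ) - halfBand N W) (fun j => halfBand N W + 1 + (j : ℕ))

/-- Guarantees that the subtraction in `numHigh` does not truncate, so that `[F F̄]` is square. -/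
lemma numLow_le {N : ℕ} {W : ℝ} (hN : 0 < N) (hW : W ∈ Set.Ioo (0 : ℝ) (1 / 2)) :
    numLow N W ≤ N := by
  have h1 : (halfBand N W : ℝ) ≤ N * W := Nat.floor_le (by have := hW.1; positivity)
  have h2 : (N : ℝ) * W < N * (1 / 2) := mul_lt_mul_of_pos_left hW.2 (by exact_mod_cast hN)
  have h3 : 2 * halfBand N W < N := by
    have : (2 * halfBand N W : ℝ) < N := by linarith
    exact_mod_cast this
  exact h3

lemma fromCols_dft_apply (N : ℕ) (W : ℝ) (n : Fin N) (c) :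
    Matrix.fromCols (lowDFT N W) (highDFT N W) n c =
      ((1 / Real.sqrt N : ℝ) : ℂ) * sinusoid N (dftFreq N W c / N) n := by
  rcases c with j | j <;> simp [lowDFT, highDFT, dftFreq]

lemma conjTranspose_fromCols_dft_mul_self {N : ℕ} {W : ℝ} (hN : 0 < N)
    (hW : W ∈ Set.Ioo (0 : ℝ) (1 / 2)) :
    (Matrix.fromCols (lowDFT N W) (highDFT N W))ᴴ *
      Matrix.fromCols (lowDFT N W) (highDFT N W) = 1 := by
  have hlow := numLow_le hN hW
  ext c d
  have hfreq : |dftFreq N W d - dftFreq N W c| < N := by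
    rw [abs_lt]
    rcases c with c | c <;> rcases d with d | d <;> simp only [dftFreq, Sum.elim_inl, Sum.elim_inr]
      <;> have := c.2 <;> have := d.2 <;> unfold numHigh numLow at * <;> omega
  have hinj : dftFreq N W c = dftFreq N W d ↔ c = d := by
    rcases c with c | c <;> rcases d with d | d <;>
      simp only [dftFreq, Sum.elim_inl, Sum.elim_inr, Sum.inl.injEq, Sum.inr.injEq, reduceCtorEq,
        Fin.ext_iff, iff_false] <;>
      have := c.2 <;> have := d.2 <;> unfold numHigh numLow at * <;> omega
  have hs : ((1 / Real.sqrt N : ℝ) : ℂ) * ((1 / Real.sqrt N : ℝ) : ℂ) * N = 1 := by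
    have hN' : (0 : ℝ) < N := by exact_mod_cast hN
    have : 1 / Real.sqrt N * (1 / Real.sqrt N) * N = 1 := by
      rw [div_mul_div_comm, one_mul, Real.mul_self_sqrt hN'.le, one_div_mul_cancel hN'.ne']
    exact_mod_cast this
  rw [Matrix.mul_apply, Matrix.one_apply]
  simp only [Matrix.conjTranspose_apply, fromCols_dft_apply, star_mul']
  have : ∀ n, star ((1 / Real.sqrt N : ℝ) : ℂ) * star (sinusoid N (dftFreq N W c / N) n) *
      (((1 / Real.sqrt N : ℝ) : ℂ) * sinusoid N (dftFreq N W d / N) n) =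
      ((1 / Real.sqrt N : ℝ) : ℂ) * ((1 / Real.sqrt N : ℝ) : ℂ) *
        (star (sinusoid N (dftFreq N W c / N) n) * sinusoid N (dftFreq N W d / N) n) := by
    intro n
    rw [RCLike.star_def, Complex.conj_ofReal]
    ring
  simp_rw [this]
  rw [← Finset.mul_sum, sum_star_sinusoid_mul_sinusoid hN hfreq]
  simp only [hinj]
  split_ifs
  · exact hs
  · exact mul_zero _

lemma dft_fromBlocks_eq_one {N : ℕ} {W : ℝ} (hN : 0 < N)
    (hW : W ∈ Set.Ioo (0 : ℝ) (1 / 2)) :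
    Matrix.fromBlocks ((lowDFT N W)ᴴ * lowDFT N W) ((lowDFT N W)ᴴ * highDFT N W)
      ((highDFT N W)ᴴ * lowDFT N W) ((highDFT N W)ᴴ * highDFT N W) = 1 := by
  rw [← conjTranspose_fromCols_dft_mul_self hN hW,
    Matrix.conjTranspose_fromCols_eq_fromRows_conjTranspose, Matrix.fromRows_mul_fromCols]

lemma lowDFT_isometry {N : ℕ} {W : ℝ} (hN : 0 < N)
    (hW : W ∈ Set.Ioo (0 : ℝ) (1 / 2)) : (lowDFT N W)ᴴ * lowDFT N W = 1 := by
  have := dft_fromBlocks_eq_one hN hW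
  rw [← Matrix.fromBlocks_one, Matrix.fromBlocks_inj] at this
  exact this.1

lemma highDFT_isometry {N : ℕ} {W : ℝ} (hN : 0 < N)
    (hW : W ∈ Set.Ioo (0 : ℝ) (1 / 2)) : (highDFT N W)ᴴ * highDFT N W = 1 := by
  have := dft_fromBlocks_eq_one hN hW
  rw [← Matrix.fromBlocks_one, Matrix.fromBlocks_inj] at this
  exact this.2.2.2

lemma lowDFT_conjTranspose_mul_highDFT {N : ℕ} {W : ℝ} (hN : 0 < N)
    (hW : W ∈ Set.Ioo (0 : ℝ) (1 / 2)) : (lowDFT N W)ᴴ * highDFT N W = 0 := by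
  have := dft_fromBlocks_eq_one hN hW
  rw [← Matrix.fromBlocks_one, Matrix.fromBlocks_inj] at this
  exact this.2.1

/-- A square matrix with orthonormal columns is unitary. -/
lemma lowDFT_mul_add_highDFT_mul {N : ℕ} {W : ℝ} (hN : 0 < N)
    (hW : W ∈ Set.Ioo (0 : ℝ) (1 / 2)) :
    lowDFT N W * (lowDFT N W)ᴴ + highDFT N W * (highDFT N W)ᴴ = 1 := by
  have h := conjTranspose_fromCols_dft_mul_self hN hW
  rw [Matrix.mul_eq_one_comm_of_card_eq] at h
  · rwa [Matrix.conjTranspose_fromCols_eq_fromRows_conjTranspose,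
      Matrix.fromCols_mul_fromRows] at h
  · have := numLow_le hN hW
    simp only [Fintype.card_sum, Fintype.card_fin]
    unfold numHigh
    omega

/-! ### Rational damping and its cost in rank. -/

lemma rank_add_vecMulVec_le {M N : ℕ} (A : Matrix (Fin M) (Fin N) ℂ) (x : Fin M → ℂ)
    (y : Fin N → ℂ) : (A + Matrix.vecMulVec x y).rank ≤ A.rank + 1 := by
  have h : LinearMap.range (A + Matrix.vecMulVec x y).mulVecLin ≤
      LinearMap.range A.mulVecLin ⊔ LinearMap.range (Matrix.vecMulVec x y).mulVecLin := by
    rintro _ ⟨z, rfl⟩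
    rw [Matrix.mulVecLin_add, LinearMap.add_apply]
    exact Submodule.add_mem_sup ⟨z, rfl⟩ ⟨z, rfl⟩
  exact (Submodule.finrank_mono h).trans ((Submodule.finrank_add_le_finrank_add_finrank _ _).trans
    (Nat.add_le_add_left (Matrix.rank_vecMulVec_le x y) _))

/-- The rational function `∏ (x - p j) / (x + p j)` with `n` factors. -/
noncomputable def rationalProd (p : ℕ → ℝ) (n : ℕ) (x : ℝ) : ℝ :=
  ∏ j ∈ Finset.range n, (x - p j) / (x + p j)

lemma rationalProd_succ (p : ℕ → ℝ) (n : ℕ) (x : ℝ) :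
    rationalProd p (n + 1) x = rationalProd p n x * ((x - p n) / (x + p n)) :=
  Finset.prod_range_succ _ _

lemma continuousOn_rationalProd {p : ℕ → ℝ} (hp : ∀ j, 0 < p j) (n : ℕ) {w : ℝ → ℝ} {s : Set ℝ}
    (hw : ContinuousOn w s) (hpos : ∀ f ∈ s, 0 < w f) :
    ContinuousOn (fun f => rationalProd p n (w f)) s := by
  unfold rationalProd
  refine continuousOn_finsetProd _ fun j _ => ContinuousOn.div (hw.sub continuousOn_const)
    (hw.add continuousOn_const) fun f hf => ?_
  have := hpos f hf
  have := hp j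
  positivity

/-- The moment matrix of a kernel, damped by `rationalProd` on both sides. -/
noncomputable def dampedMatrix {M N : ℕ} (W : ℝ) (w : ℝ → ℝ) (v : Fin M → ℝ) (K : Fin M → ℝ → ℂ)
    (p : ℕ → ℝ) (n : ℕ) : Matrix (Fin M) (Fin N) ℂ :=
  Matrix.of fun k m => (rationalProd p n (v k) : ℂ) *
    ∫ f in (-W)..W, (rationalProd p n (w f) : ℂ) * (K k f * star (sinusoid N f m))

/-- For a kernel of Cauchy type, each factor of the damping costs one unit of rank. -/
lemma rank_dampedMatrix_sub_le {M N : ℕ} {W : ℝ} (hW : 0 ≤ W) {w : ℝ → ℝ} {v : Fin M → ℝ}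
    {K : Fin M → ℝ → ℂ} {a : ℝ → ℂ} {b : Fin M → ℂ} {p : ℕ → ℝ} (hp : ∀ j, 0 < p j)
    (hw : ContinuousOn w (Set.Icc (-W) W)) (hwpos : ∀ f ∈ Set.Icc (-W) W, 0 < w f)
    (hv : ∀ k, 0 < v k) (hK : ∀ k, Continuous (K k))
    (hab : ∀ k, ∀ f ∈ Set.Icc (-W) W, K k f * ((w f + v k : ℝ) : ℂ) = a f * b k) (n : ℕ) :
    (dampedMatrix W w v K p 0 - dampedMatrix W w v K p n : Matrix (Fin M) (Fin N) ℂ).rank ≤ n := by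
  induction n with
  | zero => simp
  | succ n ih =>
    have hWW : -W ≤ W := by linarith
    -- With w = w(f) and v = v_k, 1 - (w-p)(v-p)/((w+p)(v+p)) = 2p(w+v)/((w+p)(v+p)). By `hab` the
    -- factor w + v turns the kernel into a product a(f) b(k), so the difference is an outer
    -- product.
    have hstep : (dampedMatrix W w v K p n - dampedMatrix W w v K p (n + 1) :
        Matrix (Fin M) (Fin N) ℂ) = Matrix.vecMulVec
          (fun k => (rationalProd p n (v k) : ℂ) * b k / ((v k + p n : ℝ) : ℂ))
          (fun m => ∫ f in (-W)..W, (rationalProd p n (w f) : ℂ) * a f *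
            (2 * p n / (w f + p n) : ℝ) * star (sinusoid N f m)) := by
      ext k m
      have hIntegrable : ∀ n : ℕ, IntervalIntegrable (fun f : ℝ => (rationalProd p n (w f) : ℂ) *
          (K k f * star (sinusoid N f m))) MeasureTheory.volume (-W) W := by
        intro n
        apply ContinuousOn.intervalIntegrable
        rw [Set.uIcc_of_le hWW]
        exact (Complex.continuous_ofReal.comp_continuousOn
          (continuousOn_rationalProd hp n hw hwpos)).mul
          ((hK k).mul (sinusoid_continuous N m).star).continuousOn
      rw [Matrix.sub_apply, Matrix.vecMulVec_apply]
      simp only [dampedMatrix, Matrix.of_apply]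
      rw [← intervalIntegral.integral_const_mul, ← intervalIntegral.integral_const_mul,
        ← intervalIntegral.integral_const_mul,
        ← intervalIntegral.integral_sub ((hIntegrable n).const_mul _) ((hIntegrable (n + 1)).const_mul _)]
      refine intervalIntegral.integral_congr fun f hf => ?_
      rw [Set.uIcc_of_le hWW] at hf
      have h1 : (w f + p n : ℂ) ≠ 0 := by
        have := add_pos (hwpos f hf) (hp n)
        exact_mod_cast this.ne'
      have h2 : (v k + p n : ℂ) ≠ 0 := by
        have := add_pos (hv k) (hp n)
        exact_mod_cast this.ne'
      have h3 := hab k f hf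
      simp only [rationalProd_succ]
      push_cast at h3 ⊢
      field_simp
      linear_combination (rationalProd p n (v k) : ℂ) * (rationalProd p n (w f) : ℂ) * 2 * p n *
        star (sinusoid N f m) * h3
    calc (dampedMatrix W w v K p 0 - dampedMatrix W w v K p (n + 1) :
          Matrix (Fin M) (Fin N) ℂ).rank
        = ((dampedMatrix W w v K p 0 - dampedMatrix W w v K p n) +
            (dampedMatrix W w v K p n - dampedMatrix W w v K p (n + 1)) :
            Matrix (Fin M) (Fin N) ℂ).rank := by rw [sub_add_sub_cancel]
      _ ≤ _ := by
        rw [hstep]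
        exact (rank_add_vecMulVec_le _ _ _).trans (Nat.add_le_add_right ih 1)

/-! ### Size of the rational products on [1/N, N]. -/

lemma abs_factor_le_one {x p : ℝ} (hx : 0 < x) (hp : 0 < p) : |(x - p) / (x + p)| ≤ 1 := by
  rw [abs_div, abs_of_pos (add_pos hx hp), div_le_one (add_pos hx hp), abs_le]
  constructor <;> linarith

/-- After clearing denominators this is 5(x - 3p)² ≥ 0; the worst point is the geometric mean of p
and 9p. -/
lemma abs_factor_mul_factor_le {x p : ℝ} (hp : 0 < p) (h1 : p ≤ x) (h2 : x ≤ 9 * p) :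
    |(x - p) / (x + p)| * |(x - 9 * p) / (x + 9 * p)| ≤ 1 / 4 := by
  have hx : 0 < x := hp.trans_le h1
  rw [abs_div, abs_div, abs_of_nonneg (sub_nonneg.2 h1), abs_of_nonpos (sub_nonpos.2 h2),
    abs_of_pos (by positivity : 0 < x + p), abs_of_pos (by positivity : 0 < x + 9 * p),
    div_mul_div_comm, div_le_div_iff₀ (by positivity) (by norm_num)]
  nlinarith [sq_nonneg (x - 3 * p)]

/-- The cyclic sequence of shifts `9 ^ j / N`, `0 ≤ j ≤ m`. -/
noncomputable def cyclicShift (N m : ℕ) (j : ℕ) : ℝ := 9 ^ (j % (m + 1)) / N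

lemma cyclicShift_pos {N : ℕ} (hN : 0 < N) (m j : ℕ) : 0 < cyclicShift N m j := by
  unfold cyclicShift; positivity

lemma exists_shift_bracket {c x : ℝ} (m : ℕ) (hm : 0 < m) (h1 : c ≤ x) (h2 : x ≤ 9 ^ m * c) :
    ∃ j < m, 9 ^ j * c ≤ x ∧ x ≤ 9 * (9 ^ j * c) := by
  induction m, hm using Nat.le_induction with
  | base => exact ⟨0, by simp, by simpa using h1, by simpa using h2⟩
  | succ m hm ih =>
    by_cases h : x ≤ 9 ^ m * c
    · obtain ⟨j, hj, h3⟩ := ih h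
      exact ⟨j, by omega, h3⟩
    · exact ⟨m, by omega, (not_le.1 h).le, by rw [← mul_assoc, ← pow_succ']; exact h2⟩

/-- One cycle of shifts damps the interval `[1/N, N]` by a factor of at least four. -/
lemma abs_rationalProd_cycle_le {N m : ℕ} (hN : 0 < N) (hm : 0 < m) (hNm : N ≤ 3 ^ m) {x : ℝ}
    (h1 : 1 / (N : ℝ) ≤ x) (h2 : x ≤ N) :
    |∏ j ∈ Finset.range (m + 1), (x - 9 ^ j / N) / (x + 9 ^ j / N)| ≤ 1 / 4 := by
  have hN' : (0 : ℝ) < N := by exact_mod_cast hN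
  have hx : 0 < x := lt_of_lt_of_le (by positivity) h1
  have h3 : (N : ℝ) ≤ 3 ^ m := by exact_mod_cast hNm
  -- The grid 9^j/N, 0 ≤ j ≤ m, covers [1/N, N] because N² ≤ 9^m. The two shifts around x give the
  -- factor 1/4; all others are at most 1 in modulus.
  obtain ⟨j, hj, h4, h5⟩ := exists_shift_bracket m hm h1 (by
    rw [mul_one_div, le_div_iff₀ hN']
    calc x * N ≤ N * N := by gcongr
      _ ≤ 3 ^ m * 3 ^ m := by gcongr
      _ = 9 ^ m := by rw [← mul_pow]; norm_num)
  rw [Finset.abs_prod]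
  have hsub : ({j, j + 1} : Finset ℕ) ⊆ Finset.range (m + 1) := by
    intro i hi
    simp only [Finset.mem_insert, Finset.mem_singleton, Finset.mem_range] at *
    omega
  rw [← Finset.prod_sdiff hsub, Finset.prod_pair (by omega)]
  have h6 : ∏ i ∈ Finset.range (m + 1) \ {j, j + 1}, |(x - 9 ^ i / N) / (x + 9 ^ i / N)| ≤ 1 :=
    Finset.prod_le_one (fun _ _ => abs_nonneg _) fun i _ => abs_factor_le_one hx (by positivity)
  have h7 := abs_factor_mul_factor_le (x := x) (p := 9 ^ j / N) (by positivity)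
    (by rwa [mul_one_div] at h4) (by rwa [mul_one_div] at h5)
  rw [show (9 : ℝ) * (9 ^ j / N) = 9 ^ (j + 1) / N by ring] at h7
  exact (mul_le_of_le_one_left (by positivity) h6).trans h7

lemma abs_rationalProd_cyclicShift_le {N m : ℕ} (hN : 0 < N) (hm : 0 < m) (hNm : N ≤ 3 ^ m) {x : ℝ}
    (h1 : 1 / (N : ℝ) ≤ x) (h2 : x ≤ N) (l : ℕ) :
    |rationalProd (cyclicShift N m) ((m + 1) * l) x| ≤ (1 / 4) ^ l := by
  induction l with
  | zero => simp [rationalProd]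
  | succ l ih =>
    have h : rationalProd (cyclicShift N m) ((m + 1) * (l + 1)) x =
        rationalProd (cyclicShift N m) ((m + 1) * l) x *
          ∏ j ∈ Finset.range (m + 1), (x - 9 ^ j / N) / (x + 9 ^ j / N) := by
      unfold rationalProd
      rw [mul_add_one, Finset.prod_range_add]
      congr 1
      refine Finset.prod_congr rfl fun j hj => ?_
      rw [cyclicShift, Nat.mul_add_mod, Nat.mod_eq_of_lt (Finset.mem_range.1 hj)]
    rw [h, abs_mul, pow_succ]
    exact mul_le_mul ih (abs_rationalProd_cycle_le hN hm hNm h1 h2) (abs_nonneg _) (by positivity)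

/-! ### The Cauchy-like kernel and its Möbius coordinates. -/

/-- The coefficients of `e_f` along the high frequency DFT vectors. -/
noncomputable def highKernel (N : ℕ) (W : ℝ) (k : Fin (numHigh N W)) (f : ℝ) : ℂ :=
  ((highDFT N W)ᴴ *ᵥ sinusoid N f) k

/-- The frequencies of the high frequency DFT vectors. -/
noncomputable def highFreq (N : ℕ) (W : ℝ) (k : Fin (numHigh N W)) : ℝ :=
  ((halfBand N W : ℝ) + 1 + ((k : ℕ) : ℝ)) / N

lemma continuous_highKernel (N : ℕ) (W : ℝ) (k : Fin (numHigh N W)) :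
    Continuous (highKernel N W k) := by
  unfold highKernel Matrix.mulVec dotProduct
  exact continuous_finsetSum _ fun n _ => continuous_const.mul (sinusoid_continuous N n)

lemma star_dotProduct_highKernel (N : ℕ) (W : ℝ) (α : Fin (numHigh N W) → ℂ) (f : ℝ) :
    ∑ k, star (α k) * highKernel N W k f = star (highDFT N W *ᵥ α) ⬝ᵥ sinusoid N f := by
  rw [star_mulVec_dotProduct]
  rfl

/-- The coefficients `highKernel` form a Cauchy-like kernel. -/
lemma highKernel_mul_sin {N : ℕ} (hN : 0 < N) (W : ℝ) (k : Fin (numHigh N W)) (f : ℝ) :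
    highKernel N W k f * (Real.sin (Real.pi * (highFreq N W k - f)) : ℂ) =
      (1 - Complex.exp (2 * Real.pi * Complex.I * f * N)) / (2 * Complex.I) *
        Complex.exp (-(Real.pi * Complex.I * f)) *
        (((1 / Real.sqrt N : ℝ) : ℂ) * Complex.exp (Real.pi * Complex.I * highFreq N W k)) := by
  have hNc : (N : ℂ) ≠ 0 := by exact_mod_cast hN.ne'
  set y := highFreq N W k with hy
  set z := Complex.exp (2 * Real.pi * Complex.I * (f - y)) with hz
  have h1 : highKernel N W k f = ((1 / Real.sqrt N : ℝ) : ℂ) * ∑ n ∈ Finset.range N, z ^ n := by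
    rw [highKernel, Matrix.mulVec, dotProduct, ← Fin.sum_univ_eq_sum_range fun n => z ^ n,
      Finset.mul_sum]
    refine Finset.sum_congr rfl fun n _ => ?_
    rw [Matrix.conjTranspose_apply, highDFT, Matrix.of_apply, star_mul', star_sinusoid, sinusoid,
      RCLike.star_def, Complex.conj_ofReal, mul_assoc, ← Complex.exp_add, hz,
      ← Complex.exp_nat_mul, hy, highFreq]
    congr 2
    push_cast
    ring
  -- N y is an integer, so z^N depends on f alone; this is what separates the variables in the
  -- numerator.
  have h2 : z ^ N = Complex.exp (2 * Real.pi * Complex.I * f * N) := by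
    rw [hz, ← Complex.exp_nat_mul, Complex.exp_eq_exp_iff_exists_int]
    refine ⟨-((halfBand N W : ℤ) + 1 + (k : ℕ)), ?_⟩
    rw [hy, highFreq]
    push_cast
    field_simp
    ring
  have h3 : (Real.sin (Real.pi * (y - f)) : ℂ) = (1 - z) / (2 * Complex.I) *
      Complex.exp (-(Real.pi * Complex.I * f)) * Complex.exp (Real.pi * Complex.I * y) := by
    rw [Complex.ofReal_sin, Complex.sin, mul_assoc, ← Complex.exp_add, hz, div_mul_eq_mul_div,
      one_sub_mul, ← Complex.exp_add, div_eq_div_iff two_ne_zero (by simp)]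
    rw [show -((Real.pi * (y - f) : ℝ) : ℂ) * Complex.I =
        2 * Real.pi * Complex.I * (f - y) + (-(Real.pi * Complex.I * f) + Real.pi * Complex.I * y)
        by push_cast; ring,
      show ((Real.pi * (y - f) : ℝ) : ℂ) * Complex.I =
        -(Real.pi * Complex.I * f) + Real.pi * Complex.I * y by push_cast; ring]
    linear_combination (Complex.exp (2 * Real.pi * Complex.I * (f - y) +
      (-(Real.pi * Complex.I * f) + Real.pi * Complex.I * y)) -
      Complex.exp (-(Real.pi * Complex.I * f) + Real.pi * Complex.I * y)) * 2 * Complex.I_sq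
  have h4 := mul_neg_geom_sum z N
  rw [h2] at h4
  rw [h1, h3, ← h4]
  ring

/-- Jordan's inequality sin(πu) ≥ 2u on [0, 1/2], with the reflection t ↦ 1 - t for the other half.
-/
lemma one_div_le_sin_pi_mul {N : ℕ} {t : ℝ} (h1 : 1 / (2 * N : ℝ) ≤ t)
    (h2 : t ≤ 1 - 1 / (2 * N : ℝ)) : 1 / (N : ℝ) ≤ Real.sin (Real.pi * t) := by
  have hpi := Real.pi_pos
  have key : ∀ u : ℝ, 1 / (2 * N : ℝ) ≤ u → u ≤ 1 / 2 → 1 / (N : ℝ) ≤ Real.sin (Real.pi * u) := by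
    intro u hu1 hu2
    have hu0 : 0 ≤ u := le_trans (by positivity) hu1
    have := Real.mul_le_sin (x := Real.pi * u) (by positivity) (by nlinarith)
    rw [← mul_assoc, div_mul_cancel₀ _ hpi.ne'] at this
    calc 1 / (N : ℝ) = 2 * (1 / (2 * N : ℝ)) := by ring
      _ ≤ 2 * u := by linarith
      _ ≤ _ := this
  rcases le_total t (1 / 2) with h | h
  · exact key t h1 h
  · rw [← Real.sin_pi_sub, show Real.pi - Real.pi * t = Real.pi * (1 - t) by ring]
    exact key _ (by linarith) (by linarith)

/-- The Möbius image of the frequency `f` that sends `-θ, θ` to `0, ∞`. -/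
noncomputable def mobiusFreq (θ f : ℝ) : ℝ :=
  Real.sin (Real.pi * (θ + f)) / Real.sin (Real.pi * (θ - f))

lemma div_mem_Icc_of_one_div_le {N : ℕ} (hN : 0 < N) {x y : ℝ} (hx : 1 / (N : ℝ) ≤ x) (hx1 : x ≤ 1)
    (hy : 1 / (N : ℝ) ≤ y) (hy1 : y ≤ 1) : x / y ∈ Set.Icc (1 / (N : ℝ)) N := by
  have hN' : (0 : ℝ) < N := by exact_mod_cast hN
  have hy0 : 0 < y := lt_of_lt_of_le (by positivity) hy
  constructor
  · exact hx.trans (le_div_self (le_trans (by positivity) hx) hy0 hy1)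
  · rw [div_le_iff₀ hy0]
    rw [div_le_iff₀ hN'] at hy
    linarith

/-- The pole and the zero are placed 1/(2N) outside the band, so both sines lie in [1/N, 1]. -/
lemma mobiusFreq_mem_Icc {N : ℕ} (hN : 0 < N) {W f : ℝ} (hW : W + 1 / (2 * N : ℝ) ≤ 1 / 2)
    (hf : f ∈ Set.Icc (-W) W) :
    mobiusFreq (W + 1 / (2 * N : ℝ)) f ∈ Set.Icc (1 / (N : ℝ)) N := by
  obtain ⟨h1, h2⟩ := hf
  exact div_mem_Icc_of_one_div_le hN
    (one_div_le_sin_pi_mul (by linarith) (by linarith)) (Real.sin_le_one _)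
    (one_div_le_sin_pi_mul (by linarith) (by linarith)) (Real.sin_le_one _)

lemma continuousOn_mobiusFreq {N : ℕ} (hN : 0 < N) {W : ℝ} (hW : W + 1 / (2 * N : ℝ) ≤ 1 / 2) :
    ContinuousOn (mobiusFreq (W + 1 / (2 * N : ℝ))) (Set.Icc (-W) W) := by
  unfold mobiusFreq
  refine ContinuousOn.div (by fun_prop) (by fun_prop) fun f hf => ?_
  obtain ⟨h1, h2⟩ := hf
  exact (lt_of_lt_of_le (by positivity)
    (one_div_le_sin_pi_mul (N := N) (by linarith) (by linarith))).ne'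

/-- Up to factors depending on f or y alone, 1/sin(π(y - f)) becomes a Cauchy kernel in the Möbius
coordinates. -/
lemma mobiusFreq_sub_mul {θ f y : ℝ} (hf : Real.sin (Real.pi * (θ - f)) ≠ 0)
    (hy : Real.sin (Real.pi * (y - θ)) ≠ 0) :
    mobiusFreq θ f - mobiusFreq θ y = Real.sin (Real.pi * (2 * θ)) *
      Real.sin (Real.pi * (y - f)) /
        (Real.sin (Real.pi * (θ - f)) * Real.sin (Real.pi * (y - θ))) := by
  have h : Real.sin (Real.pi * (θ - y)) = - Real.sin (Real.pi * (y - θ)) := by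
    rw [← Real.sin_neg]; ring_nf
  rw [mobiusFreq, mobiusFreq, h, div_neg, sub_neg_eq_add, div_add_div _ _ hf hy]
  congr 1
  simp only [mul_add, mul_sub, show Real.pi * (2 * θ) = 2 * (Real.pi * θ) by ring, Real.sin_add,
    Real.sin_sub, Real.sin_two_mul]
  ring

/-! ### Norm bound for damped moment matrices. -/

/-- The band lies in the full period [-1/2, 1/2], where the moment matrix is the identity
(Parseval). -/
lemma integral_norm_sq_le {N : ℕ} {W : ℝ} (hW0 : 0 ≤ W) (hW : W ≤ 1 / 2) (α : Fin N → ℂ) :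
    ∫ f in (-W)..W, ‖star α ⬝ᵥ sinusoid N f‖ ^ 2 ≤ ∑ n, ‖α n‖ ^ 2 := by
  have h1 := star_dotProduct_prolate_mulVec (1 / 2) α
  rw [prolate_half, Matrix.one_mulVec, star_dotProduct_self, Complex.ofReal_inj] at h1
  rw [h1]
  exact intervalIntegral.integral_mono_interval (by linarith) (by linarith) hW
    (Filter.Eventually.of_forall fun f => by positivity)
    (((star_dotProduct_sinusoid_continuous α).norm.pow 2).intervalIntegrable _ _)

/-- Cauchy–Schwarz in weighted arithmetic-mean form; the free weight `t` later balances an already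
damped `α` against an undamped `β`. -/
lemma norm_integral_mul_le {N : ℕ} {W : ℝ} (hW0 : 0 ≤ W) (hW : W ≤ 1 / 2) {Φ : ℝ → ℝ} {c t : ℝ}
    (hc : 0 ≤ c) (ht : 0 < t) (hΦ : ContinuousOn Φ (Set.Icc (-W) W))
    (hΦc : ∀ f ∈ Set.Icc (-W) W, |Φ f| ≤ c) (α β : Fin N → ℂ) :
    ‖∫ f in (-W)..W, (Φ f : ℂ) * ((star α ⬝ᵥ sinusoid N f) * star (star β ⬝ᵥ sinusoid N f))‖ ≤
      c * (((∑ n, ‖α n‖ ^ 2) / t + t * ∑ n, ‖β n‖ ^ 2) / 2) := by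
  have hWW : -W ≤ W := by linarith
  have hα := star_dotProduct_sinusoid_continuous α
  have hβ := star_dotProduct_sinusoid_continuous β
  have hiα : IntervalIntegrable (fun f => ‖star α ⬝ᵥ sinusoid N f‖ ^ 2 / t)
    MeasureTheory.volume (-W) W := ((hα.norm.pow 2).div_const _).intervalIntegrable _ _
  have hiβ : IntervalIntegrable (fun f => t * ‖star β ⬝ᵥ sinusoid N f‖ ^ 2)
    MeasureTheory.volume (-W) W := (continuous_const.mul (hβ.norm.pow 2)).intervalIntegrable _ _
  calc _ ≤ ∫ f in (-W)..W,
        ‖(Φ f : ℂ) * ((star α ⬝ᵥ sinusoid N f) * star (star β ⬝ᵥ sinusoid N f))‖ :=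
        intervalIntegral.norm_integral_le_integral_norm hWW
    _ ≤ ∫ f in (-W)..W, c *
        ((‖star α ⬝ᵥ sinusoid N f‖ ^ 2 / t + t * ‖star β ⬝ᵥ sinusoid N f‖ ^ 2) / 2) := by
        refine intervalIntegral.integral_mono_on hWW ?_ (((hiα.add hiβ).div_const 2).const_mul c) ?_
        · apply ContinuousOn.intervalIntegrable
          rw [Set.uIcc_of_le hWW]
          exact ((Complex.continuous_ofReal.comp_continuousOn hΦ).mul
            (hα.mul hβ.star).continuousOn).norm
        · intro f hf
          rw [norm_mul, norm_mul, norm_star, Complex.norm_real, Real.norm_eq_abs]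
          refine mul_le_mul (hΦc f hf) ?_ (by positivity) hc
          have : ‖star α ⬝ᵥ sinusoid N f‖ ^ 2 / t + t * ‖star β ⬝ᵥ sinusoid N f‖ ^ 2 -
              2 * (‖star α ⬝ᵥ sinusoid N f‖ * ‖star β ⬝ᵥ sinusoid N f‖) =
              (‖star α ⬝ᵥ sinusoid N f‖ - t * ‖star β ⬝ᵥ sinusoid N f‖) ^ 2 / t := by
            field_simp
            ring
          have h0 : 0 ≤ (‖star α ⬝ᵥ sinusoid N f‖ - t * ‖star β ⬝ᵥ sinusoid N f‖) ^ 2 / t := by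
            positivity
          linarith
    _ = c * (((∫ f in (-W)..W, ‖star α ⬝ᵥ sinusoid N f‖ ^ 2) / t +
          t * ∫ f in (-W)..W, ‖star β ⬝ᵥ sinusoid N f‖ ^ 2) / 2) := by
        rw [intervalIntegral.integral_const_mul, intervalIntegral.integral_div,
          intervalIntegral.integral_add hiα hiβ, intervalIntegral.integral_div,
          intervalIntegral.integral_const_mul]
    _ ≤ _ := by
        gcongr
        · exact integral_norm_sq_le hW0 hW α
        · exact integral_norm_sq_le hW0 hW β

/-- The quadratic form of a damped moment matrix is small where both damping factors are. -/
lemma re_dampedMatrix_le {N : ℕ} {W : ℝ} (hN : 0 < N) (hW : W ∈ Set.Ioo (0 : ℝ) (1 / 2))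
    {w : ℝ → ℝ} {v g : Fin (numHigh N W) → ℝ} {p : ℕ → ℝ} {n : ℕ} {c : ℝ} (hc : 0 < c)
    (hcont : ContinuousOn (fun f => rationalProd p n (w f)) (Set.Icc (-W) W))
    (hwc : ∀ f ∈ Set.Icc (-W) W, |rationalProd p n (w f)| ≤ c)
    (hvc : ∀ k, |rationalProd p n (v k) * g k| ≤ c)
    (α : Fin (numHigh N W) → ℂ) (β : Fin N → ℂ) :
    (star α ⬝ᵥ dampedMatrix W w v (fun k f => (g k : ℂ) * highKernel N W k f) p n *ᵥ β).re ≤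
      c * c * (((∑ i, ‖α i‖ ^ 2) + ∑ i, ‖β i‖ ^ 2) / 2) := by
  have hWW : -W ≤ W := by linarith [hW.1]
  -- The row damping and the mask `g` are moved into the vector; F̄ then acts on γ as an isometry.
  set γ : Fin (numHigh N W) → ℂ := fun k => ((rationalProd p n (v k) * g k : ℝ) : ℂ) * α k with hγ
  have hγsum : ∑ k, ‖γ k‖ ^ 2 ≤ c ^ 2 * ∑ k, ‖α k‖ ^ 2 := by
    rw [Finset.mul_sum]
    refine Finset.sum_le_sum fun k _ => ?_
    rw [hγ, norm_mul, Complex.norm_real, mul_pow, Real.norm_eq_abs]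
    gcongr
    exact hvc k
  have hIntegrable : ∀ k (m : Fin N), IntervalIntegrable (fun f : ℝ => star (γ k) *
      ((rationalProd p n (w f) : ℂ) * (highKernel N W k f * star (sinusoid N f m))) * β m)
      MeasureTheory.volume (-W) W := by
    intro k m
    apply ContinuousOn.intervalIntegrable
    rw [Set.uIcc_of_le hWW]
    exact (continuousOn_const.mul ((Complex.continuous_ofReal.comp_continuousOn hcont).mul
      ((continuous_highKernel N W k).mul (sinusoid_continuous N m).star).continuousOn)).mul
      continuousOn_const
  have hform : star α ⬝ᵥ dampedMatrix W w v (fun k f => (g k : ℂ) * highKernel N W k f) p n *ᵥ β =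
      ∫ f in (-W)..W, (rationalProd p n (w f) : ℂ) *
        ((star (highDFT N W *ᵥ γ) ⬝ᵥ sinusoid N f) * star (star β ⬝ᵥ sinusoid N f)) := by
    have h1 : ∀ f : ℝ, (rationalProd p n (w f) : ℂ) *
        ((star (highDFT N W *ᵥ γ) ⬝ᵥ sinusoid N f) * star (star β ⬝ᵥ sinusoid N f)) =
        ∑ k, ∑ m, star (γ k) * ((rationalProd p n (w f) : ℂ) *
          (highKernel N W k f * star (sinusoid N f m))) * β m := by
      intro f
      rw [← star_dotProduct_highKernel, dotProduct, star_sum, Finset.sum_mul_sum, Finset.mul_sum]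
      refine Finset.sum_congr rfl fun k _ => ?_
      rw [Finset.mul_sum]
      refine Finset.sum_congr rfl fun m _ => ?_
      rw [Pi.star_apply, star_mul' (star (β m)), star_star]
      ring
    simp_rw [h1]
    have hIntegrable' : ∀ k, IntervalIntegrable (fun f : ℝ => ∑ m, star (γ k) *
        ((rationalProd p n (w f) : ℂ) * (highKernel N W k f * star (sinusoid N f m))) * β m)
        MeasureTheory.volume (-W) W := by
      intro k
      simpa only [Finset.sum_fn] using IntervalIntegrable.sum Finset.univ fun m _ => hIntegrable k m
    rw [intervalIntegral.integral_finsetSum fun k _ => hIntegrable' k]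
    simp only [dotProduct, Matrix.mulVec]
    refine Finset.sum_congr rfl fun k _ => ?_
    rw [intervalIntegral.integral_finsetSum fun m _ => hIntegrable k m, Finset.mul_sum]
    refine Finset.sum_congr rfl fun m _ => ?_
    rw [intervalIntegral.integral_mul_const, intervalIntegral.integral_const_mul, dampedMatrix,
      Matrix.of_apply, hγ]
    have h2 : ∀ f : ℝ, (rationalProd p n (w f) : ℂ) *
        ((g k : ℂ) * highKernel N W k f * star (sinusoid N f m)) =
        (g k : ℂ) * ((rationalProd p n (w f) : ℂ) *
          (highKernel N W k f * star (sinusoid N f m))) := fun f => by ring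
    simp_rw [h2]
    rw [intervalIntegral.integral_const_mul, star_mul', Pi.star_apply, RCLike.star_def,
      Complex.conj_ofReal]
    push_cast
    ring
  rw [hform]
  -- The weight t = c is used: ‖γ‖² ≤ c²‖α‖², so both terms carry one factor c, besides the c that
  -- bounds the damping in f.
  refine (Complex.re_le_norm _).trans ((norm_integral_mul_le hW.1.le hW.2.le hc.le hc hcont hwc
    _ _).trans ?_)
  rw [sum_norm_sq_mulVec (highDFT_isometry hN hW), mul_assoc]
  gcongr
  rw [← mul_div_assoc, mul_add]
  gcongr
  rw [div_le_iff₀ hc]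
  linarith

/-- The matrix `F̄* B` is the moment matrix of `highKernel`. -/
lemma highDFT_mul_prolate_apply (N : ℕ) (W : ℝ) (k : Fin (numHigh N W)) (m : Fin N) :
    ((highDFT N W)ᴴ * prolate N W) k m =
      ∫ f in (-W)..W, highKernel N W k f * star (sinusoid N f m) := by
  have hterm : ∀ f : ℝ, highKernel N W k f * star (sinusoid N f m) =
      ∑ n, (highDFT N W)ᴴ k n * (sinusoid N f n * star (sinusoid N f m)) := by
    intro f
    rw [highKernel, Matrix.mulVec, dotProduct, Finset.sum_mul]
    exact Finset.sum_congr rfl fun n _ => by ring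
  have hIntegrable : ∀ n, IntervalIntegrable (fun f : ℝ => (highDFT N W)ᴴ k n *
      (sinusoid N f n * star (sinusoid N f m))) MeasureTheory.volume (-W) W := fun n =>
    (continuous_const.mul
      ((sinusoid_continuous N n).mul (sinusoid_continuous N m).star)).intervalIntegrable _ _
  simp_rw [hterm]
  rw [intervalIntegral.integral_finsetSum fun n _ => hIntegrable n, Matrix.mul_apply]
  refine Finset.sum_congr rfl fun n _ => ?_
  rw [intervalIntegral.integral_const_mul, integral_sinusoid_mul_star]

/-! ### Interior frequencies: removal of the two frequencies next to the band. -/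

/-- The frequencies at distance at least `1 / N` from the band. -/
def IsInterior {M : ℕ} (k : Fin M) : Prop := 1 ≤ (k : ℕ) ∧ (k : ℕ) + 2 ≤ M

instance {M : ℕ} : DecidablePred (IsInterior (M := M)) := fun k =>
  inferInstanceAs (Decidable (1 ≤ (k : ℕ) ∧ (k : ℕ) + 2 ≤ M))

lemma lt_halfBand_add_one (N : ℕ) (W : ℝ) : N * W < (halfBand N W : ℝ) + 1 := by
  exact_mod_cast Nat.lt_floor_add_one ((N : ℝ) * W)

lemma band_add_le_half {N : ℕ} {W : ℝ} (hN : 0 < N) (hM : 3 ≤ numHigh N W) :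
    W + 1 / (2 * N : ℝ) ≤ 1 / 2 := by
  have hN' : (0 : ℝ) < N := by exact_mod_cast hN
  have h1 := lt_halfBand_add_one N W
  have h2 : (2 * halfBand N W + 4 : ℝ) ≤ N := by
    have : 2 * halfBand N W + 4 ≤ N := by unfold numHigh numLow at hM; omega
    exact_mod_cast this
  rw [← mul_le_mul_iff_right₀ hN']
  have : (N : ℝ) * (W + 1 / (2 * N)) = N * W + 1 / 2 := by field_simp
  linarith

lemma highFreq_mem_Icc {N : ℕ} {W : ℝ} (hN : 0 < N) {k : Fin (numHigh N W)} (hk : IsInterior k) :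
    highFreq N W k ∈ Set.Icc (W + 1 / (N : ℝ)) (1 - W - 1 / (N : ℝ)) := by
  have hN' : (0 : ℝ) < N := by exact_mod_cast hN
  have h1 := lt_halfBand_add_one N W
  obtain ⟨h2, h3⟩ := hk
  have h4 : (1 : ℝ) ≤ (k : ℕ) := by exact_mod_cast h2
  have h5 : (2 * halfBand N W + 3 + (k : ℕ) : ℝ) ≤ N := by
    have : 2 * halfBand N W + 3 + (k : ℕ) ≤ N := by unfold numHigh numLow at h3; omega
    exact_mod_cast this
  have h6 : (1 / (N : ℝ)) * N = 1 := one_div_mul_cancel hN'.ne'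
  unfold highFreq
  constructor
  · rw [le_div_iff₀ hN']
    linarith
  · rw [div_le_iff₀ hN']
    linarith

/-- The Möbius images, up to sign, of the interior frequencies. -/
noncomputable def highNode (N : ℕ) (W : ℝ) (k : Fin (numHigh N W)) : ℝ :=
  if IsInterior k then -mobiusFreq (W + 1 / (2 * N : ℝ)) (highFreq N W k) else 1

lemma sin_highFreq_sub_pos {N : ℕ} {W : ℝ} (hN : 0 < N) (hW : 0 < W)
    {k : Fin (numHigh N W)} (hk : IsInterior k) :
    1 / (N : ℝ) ≤ Real.sin (Real.pi * (highFreq N W k - (W + 1 / (2 * N : ℝ)))) := by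
  obtain ⟨h1, h2⟩ := highFreq_mem_Icc hN hk
  have h3 : 1 / (N : ℝ) = 1 / (2 * N : ℝ) + 1 / (2 * N : ℝ) := by ring
  have h4 : 0 ≤ 1 / (2 * N : ℝ) := by positivity
  exact one_div_le_sin_pi_mul (by linarith) (by linarith)

lemma highNode_mem_Icc {N : ℕ} {W : ℝ} (hN : 0 < N) (hW : 0 < W) (k : Fin (numHigh N W)) :
    highNode N W k ∈ Set.Icc (1 / (N : ℝ)) N := by
  have hN1 : (1 : ℝ) ≤ N := by exact_mod_cast hN
  unfold highNode
  split_ifs with hk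
  · have h := sin_highFreq_sub_pos hN hW hk
    obtain ⟨h1, h2⟩ := highFreq_mem_Icc hN hk
    have h3 : 1 / (N : ℝ) = 1 / (2 * N : ℝ) + 1 / (2 * N : ℝ) := by ring
    have h4 : 0 ≤ 1 / (2 * N : ℝ) := by positivity
    rw [mobiusFreq, ← div_neg, ← Real.sin_neg, ← mul_neg, neg_sub]
    exact div_mem_Icc_of_one_div_le hN
      (one_div_le_sin_pi_mul (by linarith) (by linarith)) (Real.sin_le_one _) h (Real.sin_le_one _)
  · exact ⟨by rw [div_le_one (by linarith)]; exact hN1, hN1⟩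

/-- The restriction of `highKernel` to the interior frequencies. -/
noncomputable def interiorKernel (N : ℕ) (W : ℝ) (k : Fin (numHigh N W)) (f : ℝ) : ℂ :=
  ((if IsInterior k then 1 else 0 : ℝ) : ℂ) * highKernel N W k f

/-- The Cauchy structure required by `rank_dampedMatrix_sub_le`: a factor in f times a factor in k.
-/
lemma interiorKernel_mul {N : ℕ} {W : ℝ} (hN : 0 < N) (hW : 0 < W) (hM : 3 ≤ numHigh N W)
    (k : Fin (numHigh N W)) {f : ℝ} (hf : f ∈ Set.Icc (-W) W) :
    interiorKernel N W k f *
        ((mobiusFreq (W + 1 / (2 * N : ℝ)) f + highNode N W k : ℝ) : ℂ) =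
      ((1 - Complex.exp (2 * Real.pi * Complex.I * f * N)) / (2 * Complex.I) *
        Complex.exp (-(Real.pi * Complex.I * f)) /
          (Real.sin (Real.pi * (W + 1 / (2 * N : ℝ) - f)) : ℝ)) *
      (if IsInterior k then (Real.sin (Real.pi * (2 * (W + 1 / (2 * N : ℝ)))) : ℝ) *
        (((1 / Real.sqrt N : ℝ) : ℂ) * Complex.exp (Real.pi * Complex.I * highFreq N W k)) /
          (Real.sin (Real.pi * (highFreq N W k - (W + 1 / (2 * N : ℝ)))) : ℝ) else 0) := by
  have hN' : 0 < 1 / (N : ℝ) := by positivity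
  unfold interiorKernel highNode
  split_ifs with hk
  · have h1 : Real.sin (Real.pi * (W + 1 / (2 * N : ℝ) - f)) ≠ 0 := by
      have := band_add_le_half hN hM
      obtain ⟨h1, h2⟩ := hf
      exact (hN'.trans_le (one_div_le_sin_pi_mul (by linarith) (by linarith))).ne'
    have h2 := (hN'.trans_le (sin_highFreq_sub_pos hN hW hk)).ne'
    have h3 := highKernel_mul_sin hN W k f
    rw [← sub_eq_add_neg, mobiusFreq_sub_mul h1 h2]
    rw [Complex.ofReal_div, Complex.ofReal_mul, Complex.ofReal_mul, Complex.ofReal_one, one_mul]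
    have h1' := Complex.ofReal_ne_zero.2 h1
    have h2' := Complex.ofReal_ne_zero.2 h2
    rw [div_mul_div_comm, mul_div_assoc', div_left_inj' (mul_ne_zero h1' h2')]
    linear_combination (Real.sin (Real.pi * (2 * (W + 1 / (2 * N : ℝ)))) : ℂ) * h3
  · simp

/-- Removing the first and the last row costs two units of rank. -/
lemma rank_sub_le_of_interior_rows_eq {M N : ℕ} (hM : 3 ≤ M) {A B : Matrix (Fin M) (Fin N) ℂ}
    (hB : ∀ k m, B k m = if IsInterior k then A k m else 0) (C : Matrix (Fin M) (Fin N) ℂ) :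
    (A - C).rank ≤ (B - C).rank + 2 := by
  have h : A - C = B - C + Matrix.vecMulVec (Pi.single ⟨0, by omega⟩ 1) (A ⟨0, by omega⟩) +
      Matrix.vecMulVec (Pi.single ⟨M - 1, by omega⟩ 1) (A ⟨M - 1, by omega⟩) := by
    ext k m
    simp only [Matrix.add_apply, Matrix.sub_apply, Matrix.vecMulVec_apply, hB, Pi.single_apply]
    by_cases h0 : k = ⟨0, by omega⟩
    · have h1 : k ≠ ⟨M - 1, by omega⟩ := by rw [h0, Ne, Fin.mk.injEq]; omega
      have h2 : ¬ IsInterior k := by rw [h0, IsInterior]; simp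
      rw [if_neg h2, if_pos h0, if_neg h1, h0]
      ring
    · by_cases h1 : k = ⟨M - 1, by omega⟩
      · have h2 : ¬ IsInterior k := by rw [h1, IsInterior]; simp; omega
        rw [if_neg h2, if_neg h0, if_pos h1, h1]
        ring
      · have h2 : IsInterior k := by
          rw [Fin.ext_iff] at h0 h1
          have := k.2
          simp only at h0 h1
          exact ⟨by omega, by omega⟩
        rw [if_pos h2, if_neg h0, if_neg h1]
        ring
  rw [h]
  exact (rank_add_vecMulVec_le _ _ _).trans (Nat.add_le_add_right (rank_add_vecMulVec_le _ _ _) 1)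

/-! ### Exponential decay of the singular values. -/

section SingularValues

variable {N : ℕ} {W : ℝ} {U : Matrix (Fin (numHigh N W)) (Fin (numHigh N W)) ℂ}
  {s : Fin (numHigh N W) → ℝ} {X : Matrix (Fin N) (Fin (numHigh N W)) ℂ}

/-- The undamped case n = 0, compared with the zero matrix; it serves the indices below the first
full cycle. -/
lemma singularValue_le_one (hN : 0 < N) (hW : W ∈ Set.Ioo (0 : ℝ) (1 / 2))
    (hA : IsSVD ((highDFT N W)ᴴ * prolate N W) U s X) (i : Fin (numHigh N W)) : s i ≤ 1 := by
  refine hA.singularValue_le i (L := 0) (by simp) fun α β => ?_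
  have h := re_dampedMatrix_le hN hW (w := fun _ => 1) (v := fun _ => 1) (g := fun _ => 1)
    (p := fun _ => 1) (n := 0) one_pos (by simpa [rationalProd] using continuousOn_const)
    (by simp [rationalProd]) (by simp [rationalProd]) α β
  rw [one_mul] at h
  convert h using 5
  ext k m
  rw [sub_zero, highDFT_mul_prolate_apply]
  simp [dampedMatrix, rationalProd]

/-- Geometric decay of the singular values of `F̄* B`. -/
lemma singularValue_le_pow (hN : 0 < N) (hW : W ∈ Set.Ioo (0 : ℝ) (1 / 2))
    (hA : IsSVD ((highDFT N W)ᴴ * prolate N W) U s X) (i : Fin (numHigh N W)) {m l : ℕ}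
    (hm : 0 < m) (hNm : N ≤ 3 ^ m) (hM : 3 ≤ numHigh N W) (hi : (m + 1) * l + 2 ≤ i) :
    s i ≤ (1 / 4) ^ l * (1 / 4) ^ l := by
  set G : ℕ → Matrix (Fin (numHigh N W)) (Fin N) ℂ :=
    dampedMatrix W (mobiusFreq (W + 1 / (2 * N : ℝ))) (highNode N W) (interiorKernel N W)
      (cyclicShift N m) with hG
  have hN' : 0 < 1 / (N : ℝ) := by positivity
  have hhalf := band_add_le_half hN hM
  have hwpos : ∀ f ∈ Set.Icc (-W) W, 0 < mobiusFreq (W + 1 / (2 * N : ℝ)) f := fun f hf =>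
    hN'.trans_le (mobiusFreq_mem_Icc hN hhalf hf).1
  have hG0 : ∀ k n, G 0 k n =
      if IsInterior k then ((highDFT N W)ᴴ * prolate N W) k n else 0 := by
    intro k n
    simp only [highDFT_mul_prolate_apply]
    by_cases hk : IsInterior k <;> simp [hG, dampedMatrix, rationalProd, interiorKernel, hk]
  -- `L` is chosen so that `A - L` is the damped interior matrix; its rank is at most (m+1)l from
  -- the damping plus 2 from the discarded rows.
  refine hA.singularValue_le i
    (L := (highDFT N W)ᴴ * prolate N W - G ((m + 1) * l)) ?_ fun α β => ?_
  · refine (rank_sub_le_of_interior_rows_eq hM hG0 _).trans (le_trans ?_ hi)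
    exact Nat.add_le_add_right (rank_dampedMatrix_sub_le hW.1.le (cyclicShift_pos hN m)
      (continuousOn_mobiusFreq hN hhalf) hwpos
      (fun k => hN'.trans_le (highNode_mem_Icc hN hW.1 k).1)
      (fun k => continuous_const.mul (continuous_highKernel N W k))
      (fun k f hf => interiorKernel_mul hN hW.1 hM k hf) _) 2
  · rw [sub_sub_cancel]
    refine re_dampedMatrix_le hN hW (by positivity)
      (continuousOn_rationalProd (cyclicShift_pos hN m) _ (continuousOn_mobiusFreq hN hhalf) hwpos)
      (fun f hf => ?_) (fun k => ?_) α β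
    · obtain ⟨h1, h2⟩ := mobiusFreq_mem_Icc hN hhalf hf
      exact abs_rationalProd_cyclicShift_le hN hm hNm h1 h2 l
    · obtain ⟨h1, h2⟩ := highNode_mem_Icc hN hW.1 k
      rw [abs_mul]
      refine (mul_le_of_le_one_right (abs_nonneg _) ?_).trans
        (abs_rationalProd_cyclicShift_le hN hm hNm h1 h2 l)
      split_ifs <;> simp

lemma constC_ge (hN : 0 < N) : 2 / 5 * Real.log N + 6 ≤ constC N := by
  have hN1 : (1 : ℝ) ≤ N := by exact_mod_cast hN
  have h1 : 0 ≤ Real.log N := Real.log_nonneg hN1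
  have h2 : Real.log N ≤ Real.log (8 * N) := Real.log_le_log (by linarith) (by linarith)
  have h3 : (2 / 5 : ℝ) ≤ 4 / Real.pi ^ 2 := by
    rw [le_div_iff₀ (by positivity)]
    nlinarith [Real.pi_pos, Real.pi_lt_d2]
  unfold constC
  have := mul_le_mul h3 h2 h1 (by positivity)
  linarith

/-- Used twice: 1/16 ≤ e^(-5/2) is the gain of a cycle, and the prefactor 15 absorbs the incomplete
last cycle. -/
lemma exp_five_halves_le : Real.exp (5 / 2) ≤ 15 := by
  have h1 : Real.exp (5 / 2) ^ 2 = Real.exp 1 ^ 5 := by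
    rw [← Real.exp_nat_mul, ← Real.exp_nat_mul]; norm_num
  have h2 : Real.exp 1 ^ 5 ≤ 2.72 ^ 5 :=
    pow_le_pow_left₀ (Real.exp_pos _).le (Real.exp_one_lt_d9.le.trans (by norm_num)) 5
  nlinarith [Real.exp_pos (5 / 2)]

lemma clog_three_le {N : ℕ} (hN : 2 ≤ N) : (Nat.clog 3 N : ℝ) ≤ Real.log N + 1 := by
  have h1 : 3 ^ (Nat.clog 3 N - 1) < N := Nat.pow_pred_clog_lt_self (by norm_num) hN
  have h0 : 0 < Nat.clog 3 N := Nat.clog_pos (by norm_num) hN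
  have h2 : ((Nat.clog 3 N - 1 : ℕ) : ℝ) * Real.log 3 ≤ Real.log N := by
    rw [← Real.log_pow]
    exact Real.log_le_log (by positivity) (by exact_mod_cast h1.le)
  have h3 : 1 ≤ Real.log 3 := by
    rw [Real.le_log_iff_exp_le (by norm_num)]
    exact Real.exp_one_lt_d9.le.trans (by norm_num)
  have h4 : ((Nat.clog 3 N - 1 : ℕ) : ℝ) ≤ Real.log N :=
    (le_mul_of_one_le_right (by positivity) h3).trans h2
  rw [Nat.cast_sub h0] at h4
  push_cast at h4
  linarith

lemma singularValue_le_exp (hN : 0 < N) (hW : W ∈ Set.Ioo (0 : ℝ) (1 / 2))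
    (hA : IsSVD ((highDFT N W)ᴴ * prolate N W) U s X) (i : Fin (numHigh N W)) :
    s i ≤ 15 * Real.exp (-((i : ℕ) / constC N)) := by
  have hN2 : 2 ≤ N := by have := i.2; unfold numHigh numLow at this; omega
  set m := Nat.clog 3 N with hm
  have hm0 : 0 < m := Nat.clog_pos (by norm_num) hN2
  -- The number of full cycles affordable at index i after paying 2 for the discarded rows; for i <
  -- 2 the subtraction truncates and l = 0.
  set l := ((i : ℕ) - 2) / (m + 1) with hl
  have hil : (i : ℕ) < (m + 1) * (l + 1) + 2 := by
    have := Nat.lt_mul_div_succ ((i : ℕ) - 2) (Nat.succ_pos m)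
    rw [← hl] at this
    simp only [Nat.succ_eq_add_one] at this
    omega
  have hs : s i ≤ (1 / 4) ^ l * (1 / 4) ^ l := by
    rcases Nat.eq_zero_or_pos l with h | h
    · rw [h]
      simpa using singularValue_le_one hN hW hA i
    · have h1 : (m + 1) * l ≤ (i : ℕ) - 2 := Nat.mul_div_le _ _
      have h2 : 1 ≤ (m + 1) * l := Nat.mul_pos (by omega) h
      exact singularValue_le_pow hN hW hA i hm0 (Nat.le_pow_clog (by norm_num) N)
        (by have := i.2; omega) (by omega)
  have hlog : 0 ≤ Real.log N := Real.log_nonneg (by exact_mod_cast hN)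
  have hC := constC_ge hN
  have hC0 : 0 < constC N := by linarith
  have hmlog := clog_three_le hN2
  rw [← hm] at hmlog
  -- i ≤ (log N + 2)(l + 1) + 2, while (5/2)(l + 1) C_N ≥ (l + 1)(log N + 15).
  have hi : ((i : ℕ) : ℝ) / constC N ≤ 5 / 2 * (l + 1) := by
    rw [div_le_iff₀ hC0]
    have h1 : ((i : ℕ) : ℝ) ≤ (m + 1) * (l + 1) + 2 := by exact_mod_cast hil.le
    have h2 : (m + 1 : ℝ) * (l + 1) ≤ (Real.log N + 2) * (l + 1) :=
      mul_le_mul_of_nonneg_right (by linarith) (by positivity)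
    have h3 : 5 / 2 * (l + 1 : ℝ) * (2 / 5 * Real.log N + 6) ≤ 5 / 2 * (l + 1) * constC N := by
      gcongr
    have hl0 : (0 : ℝ) ≤ l := by positivity
    nlinarith
  have h16 : (1 / 4 : ℝ) ^ l * (1 / 4) ^ l ≤ Real.exp (-(5 / 2)) ^ l := by
    rw [← mul_pow]
    refine pow_le_pow_left₀ (by norm_num) ?_ l
    rw [Real.exp_neg, ← one_div, le_div_iff₀ (Real.exp_pos _)]
    have := exp_five_halves_le
    linarith
  calc s i ≤ Real.exp (-(5 / 2)) ^ l := hs.trans h16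
    _ = Real.exp (5 / 2) * Real.exp (-(5 / 2 * (l + 1))) := by
        rw [← Real.exp_nat_mul, ← Real.exp_add]; ring_nf
    _ ≤ 15 * Real.exp (-((i : ℕ) / constC N)) := by
        gcongr
        exact exp_five_halves_le

end SingularValues

/-! ### Summation of the tail. -/

/-- Telescoping, since C(e^(1/C) - 1) ≥ 1. The exponent r - 1 in the bound is compensated by the `+
1` in `numR`. -/
lemma sum_exp_neg_div_le {C : ℝ} (hC : 0 < C) (r M : ℕ) :
    ∑ i ∈ Finset.range M with r ≤ i, Real.exp (-(i / C)) ≤ C * Real.exp (-((r - 1) / C)) := by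
  have hstep : ∀ i : ℕ, Real.exp (-(i / C)) ≤
      C * (Real.exp (-((i - 1) / C)) - Real.exp (-(i / C))) := by
    intro i
    have h1 : Real.exp (-((i - 1) / C)) = Real.exp (-(i / C)) * Real.exp (1 / C) := by
      rw [← Real.exp_add]; ring_nf
    have h2 : 1 ≤ C * (Real.exp (1 / C) - 1) := by
      have := mul_le_mul_of_nonneg_left (Real.add_one_le_exp (1 / C)) hC.le
      rw [mul_add, mul_one_div_cancel hC.ne'] at this
      linarith
    rw [h1]
    nlinarith [Real.exp_pos (-(i / C))]
  have hsum : ∀ M : ℕ, r ≤ M → ∑ i ∈ Finset.range M with r ≤ i, Real.exp (-(i / C)) ≤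
      C * (Real.exp (-((r - 1) / C)) - Real.exp (-((M - 1) / C))) := by
    intro M hM
    induction M, hM using Nat.le_induction with
    | base =>
      rw [Finset.sum_eq_zero, sub_self, mul_zero]
      intro i hi
      simp only [Finset.mem_filter, Finset.mem_range] at hi
      omega
    | succ M hM ih =>
      rw [Finset.range_add_one, Finset.filter_insert, if_pos hM, Finset.sum_insert (by simp)]
      have := hstep M
      push_cast
      rw [add_sub_cancel_right]
      linarith
  rcases le_total r M with h | h
  · refine (hsum M h).trans (mul_le_mul_of_nonneg_left ?_ hC.le)
    linarith [Real.exp_pos (-((M - 1) / C))]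
  · rw [Finset.sum_eq_zero]
    · positivity
    · intro i hi
      simp only [Finset.mem_filter, Finset.mem_range] at hi
      omega

/-- The tail of the singular values beyond the index `min R M` is at most `N ε`. -/
lemma sum_singularValue_le {N : ℕ} {W : ℝ} {U : Matrix (Fin (numHigh N W)) (Fin (numHigh N W)) ℂ}
    {s : Fin (numHigh N W) → ℝ} {X : Matrix (Fin N) (Fin (numHigh N W)) ℂ} (hN : 0 < N)
    (hW : W ∈ Set.Ioo (0 : ℝ) (1 / 2)) (hA : IsSVD ((highDFT N W)ᴴ * prolate N W) U s X)
    {ε : ℝ} (hε : 0 < ε) :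
    (∑ i : Fin (numHigh N W), if min (numR N ε) (numHigh N W) ≤ (i : ℕ) then s i else 0) ≤ N * ε := by
  have hN' : (0 : ℝ) < N := by exact_mod_cast hN
  have hlog : 0 ≤ Real.log N := Real.log_nonneg (by exact_mod_cast hN)
  have hC0 : 0 < constC N := by linarith [constC_ge hN]
  have hR : constC N * Real.log (15 * constC N / (N * ε)) ≤ (numR N ε : ℝ) - 1 := by
    have h1 : (⌈constC N * Real.log (15 * constC N / (N * ε))⌉ + 1 : ℤ) ≤ (numR N ε : ℤ) := by
      unfold numR
      rw [Int.toNat_of_nonneg (le_max_right _ _)]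
      exact le_max_left _ _
    have h2 : ((⌈constC N * Real.log (15 * constC N / (N * ε))⌉ : ℝ) + 1) ≤ (numR N ε : ℝ) := by
      exact_mod_cast h1
    linarith [Int.le_ceil (constC N * Real.log (15 * constC N / (N * ε)))]
  -- R is exactly large enough for 15 C_N exp(-(R - 1)/C_N) ≤ Nε.
  have hexp : Real.exp (-(((numR N ε : ℝ) - 1) / constC N)) ≤ N * ε / (15 * constC N) := by
    rw [← Real.exp_log (show 0 < N * ε / (15 * constC N) by positivity), Real.exp_le_exp,
      ← inv_div (15 * constC N), Real.log_inv, neg_le_neg_iff, le_div_iff₀ hC0]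
    linarith
  calc (∑ i : Fin (numHigh N W), if min (numR N ε) (numHigh N W) ≤ (i : ℕ) then s i else 0)
      ≤ ∑ i : Fin (numHigh N W), if numR N ε ≤ (i : ℕ) then
          15 * Real.exp (-((i : ℕ) / constC N)) else 0 := by
        refine Finset.sum_le_sum fun i _ => ?_
        have hi : min (numR N ε) (numHigh N W) ≤ (i : ℕ) ↔ numR N ε ≤ (i : ℕ) := by
          have := i.2
          omega
        simp only [hi]
        split_ifs
        · exact singularValue_le_exp hN hW hA i
        · exact le_rfl
    _ = 15 * ∑ i ∈ Finset.range (numHigh N W) with numR N ε ≤ i,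
          Real.exp (-(i / constC N)) := by
        rw [Fin.sum_univ_eq_sum_range fun i : ℕ => if numR N ε ≤ i then
          15 * Real.exp (-(i / constC N)) else 0, ← Finset.sum_filter, Finset.mul_sum]
    _ ≤ 15 * (constC N * (N * ε / (15 * constC N))) := by
        gcongr
        exact (sum_exp_neg_div_le hC0 _ _).trans (by gcongr)
    _ = N * ε := by field_simp

/-! ### The residual projection and its mean energy. -/

lemma submatrix_castLE_mul_conjTranspose {M r : ℕ} (hr : r ≤ M) (U : Matrix (Fin M) (Fin M) ℂ) :
    U.submatrix id (Fin.castLE hr) * (U.submatrix id (Fin.castLE hr))ᴴ =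
      U * Matrix.diagonal (fun i : Fin M => if r ≤ (i : ℕ) then (0 : ℂ) else 1) * Uᴴ := by
  ext a b
  rw [Matrix.mul_apply, Matrix.mul_apply]
  simp only [Matrix.mul_diagonal, Matrix.conjTranspose_apply, Matrix.submatrix_apply, id_eq]
  rw [← Finset.sum_filter_add_sum_filter_not Finset.univ fun i : Fin M => r ≤ (i : ℕ)]
  rw [Finset.sum_eq_zero (s := Finset.univ.filter fun i : Fin M => r ≤ (i : ℕ)), zero_add]
  · refine Finset.sum_bij (fun j _ => Fin.castLE hr j) ?_ ?_ ?_ ?_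
    · intro j _
      simp
    · intro j _ j' _ h
      exact Fin.castLE_injective hr h
    · intro i hi
      simp only [Finset.mem_filter, Finset.mem_univ, true_and, not_le] at hi
      exact ⟨⟨i, hi⟩, Finset.mem_univ _, rfl⟩
    · intro j _
      rw [if_neg (by simp), mul_one]
  · intro i hi
    rw [if_pos (Finset.mem_filter.1 hi).2, mul_zero, zero_mul]

section Residual

variable {N : ℕ} {W : ℝ} {r : ℕ}

lemma basis_isometry (hN : 0 < N) (hW : W ∈ Set.Ioo (0 : ℝ) (1 / 2))
    {V : Matrix (Fin (numHigh N W)) (Fin r) ℂ} (hV : Vᴴ * V = 1) :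
    (basis N W V)ᴴ * basis N W V = 1 := by
  have h0 := lowDFT_conjTranspose_mul_highDFT hN hW
  have h0' : (highDFT N W)ᴴ * lowDFT N W = 0 := by
    rw [← Matrix.conjTranspose_conjTranspose (lowDFT N W), ← Matrix.conjTranspose_mul, h0,
      Matrix.conjTranspose_zero]
  rw [basis, Matrix.conjTranspose_fromCols_eq_fromRows_conjTranspose, Matrix.fromRows_mul_fromCols,
    lowDFT_isometry hN hW, Matrix.conjTranspose_mul, ← Matrix.mul_assoc, h0, Matrix.zero_mul,
    Matrix.mul_assoc, h0', Matrix.mul_zero, Matrix.mul_assoc, ← Matrix.mul_assoc _ (highDFT N W),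
    highDFT_isometry hN hW, Matrix.one_mul, hV, Matrix.fromBlocks_one]

/-- By completeness of the DFT vectors I - QQ* = F̄(I - VV*)F̄*, and `U` diagonalizes I - VV*. -/
lemma one_sub_basis_mul (hN : 0 < N) (hW : W ∈ Set.Ioo (0 : ℝ) (1 / 2))
    {U : Matrix (Fin (numHigh N W)) (Fin (numHigh N W)) ℂ} (hU : U * Uᴴ = 1)
    (hr : r ≤ numHigh N W) :
    1 - basis N W (U.submatrix id (Fin.castLE hr)) *
        (basis N W (U.submatrix id (Fin.castLE hr)))ᴴ =
      (highDFT N W * U) * (Matrix.diagonal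
        (fun i : Fin (numHigh N W) => if r ≤ (i : ℕ) then (1 : ℂ) else 0) *
        (highDFT N W * U)ᴴ) := by
  have h1 : (Matrix.diagonal (fun i : Fin (numHigh N W) => if r ≤ (i : ℕ) then (1 : ℂ) else 0)) =
      1 - Matrix.diagonal (fun i : Fin (numHigh N W) => if r ≤ (i : ℕ) then (0 : ℂ) else 1) := by
    rw [← Matrix.diagonal_one, Matrix.diagonal_sub]
    congr 1
    ext i
    split_ifs <;> simp
  rw [basis, Matrix.conjTranspose_fromCols_eq_fromRows_conjTranspose, Matrix.fromCols_mul_fromRows,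
    Matrix.conjTranspose_mul, ← lowDFT_mul_add_highDFT_mul hN hW, add_sub_add_left_eq_sub, h1,
    Matrix.sub_mul, Matrix.one_mul, Matrix.mul_sub, Matrix.conjTranspose_mul]
  congr 1
  · rw [Matrix.mul_assoc, ← Matrix.mul_assoc U, hU, Matrix.one_mul]
  · rw [Matrix.mul_assoc, ← Matrix.mul_assoc (U.submatrix _ _), submatrix_castLE_mul_conjTranspose]
    simp only [Matrix.mul_assoc]

/-- The mean energy of `e_f` along a left singular vector is at most the singular value. -/
lemma integral_norm_sq_leftSingular_le {U : Matrix (Fin (numHigh N W)) (Fin (numHigh N W)) ℂ}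
    {s : Fin (numHigh N W) → ℝ} {X : Matrix (Fin N) (Fin (numHigh N W)) ℂ} (hN : 0 < N)
    (hW : W ∈ Set.Ioo (0 : ℝ) (1 / 2)) (hA : IsSVD ((highDFT N W)ᴴ * prolate N W) U s X)
    (i : Fin (numHigh N W)) :
    ∫ f in (-W)..W, ‖((highDFT N W * U)ᴴ *ᵥ sinusoid N f) i‖ ^ 2 ≤ s i := by
  have hU : Uᴴ * U = 1 := Matrix.mem_unitaryGroup_iff'.1 hA.left_unitary
  set G := highDFT N W * U with hG
  have hGG : Gᴴ * G = 1 := by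
    rw [hG, Matrix.conjTranspose_mul, Matrix.mul_assoc, ← Matrix.mul_assoc _ (highDFT N W),
      highDFT_isometry hN hW, Matrix.one_mul, hU]
  have hcol : ∀ {M : Matrix (Fin N) (Fin (numHigh N W)) ℂ}, Mᴴ * M = 1 →
      ∑ n, ‖M n i‖ ^ 2 = 1 := by
    intro M hM
    have := sum_norm_sq_mulVec hM (Pi.single i 1)
    simpa [Pi.single_apply, apply_ite] using this
  have h1 := star_dotProduct_prolate_mulVec W (fun n => G n i)
  -- (F̄U)*B = U*A = ΣX*, so the quadratic form of B at g_i is s_i times the inner product of the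
  -- unit vectors x_i and g_i.
  have h2 : (star fun n => G n i) ⬝ᵥ prolate N W *ᵥ (fun n => G n i) =
      (s i : ℂ) * ((star fun n => X n i) ⬝ᵥ fun n => G n i) := by
    have h3 : Gᴴ * prolate N W * G = Matrix.diagonal (fun i => (s i : ℂ)) * (Xᴴ * G) := by
      rw [hG, Matrix.conjTranspose_mul, Matrix.mul_assoc Uᴴ, hA.eq, Matrix.mul_assoc U,
        ← Matrix.mul_assoc Uᴴ, hU, Matrix.one_mul, Matrix.mul_assoc]
    have h4 := congrFun (congrFun h3 i) i
    rw [Matrix.diagonal_mul, Matrix.mul_assoc] at h4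
    exact h4
  rw [h2] at h1
  have h5 : ∫ f in (-W)..W, ‖(Gᴴ *ᵥ sinusoid N f) i‖ ^ 2 =
      s i * ((star fun n => X n i) ⬝ᵥ fun n => G n i).re := by
    rw [← Complex.re_ofReal_mul, h1, Complex.ofReal_re]
    rfl
  rw [h5]
  refine mul_le_of_le_one_right (hA.nonneg i) ((re_star_dotProduct_le _ _).trans ?_)
  rw [hcol hA.right_orthonormal, hcol hGG]
  norm_num

end Residual

end Roast

theorem theorem4 (N : ℕ) (hN : 0 < N) (W : ℝ) (hW : W ∈ Set.Ioo (0 : ℝ) (1 / 2))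
    (ε : ℝ) (hε : ε ∈ Set.Ioo (0 : ℝ) (1 / 2))
    (V : Matrix (Fin (Roast.numHigh N W))
      (Fin (min (Roast.numR N ε) (Roast.numHigh N W))) ℂ)
    (hV : Roast.IsDominantLeft ((Roast.highDFT N W)ᴴ * Roast.prolate N W) V) :
    (Roast.basis N W V)ᴴ * Roast.basis N W V = 1 ∧
    ∫ f in (-W)..W,
      Roast.norm2 (Roast.sinusoid N f -
          (Roast.basis N W V * (Roast.basis N W V)ᴴ) *ᵥ Roast.sinusoid N f) ^ 2 /
        Roast.norm2 (Roast.sinusoid N f) ^ 2 ≤ ε := by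
  obtain ⟨U, s, X, hA, hr, rfl⟩ := hV
  have hU : Uᴴ * U = 1 := Matrix.mem_unitaryGroup_iff'.1 hA.left_unitary
  have hU' : U * Uᴴ = 1 := Matrix.mem_unitaryGroup_iff.1 hA.left_unitary
  have hN' : (0 : ℝ) < N := by exact_mod_cast hN
  set G := Roast.highDFT N W * U with hG
  have hGG : Gᴴ * G = 1 := by
    rw [hG, Matrix.conjTranspose_mul, Matrix.mul_assoc, ← Matrix.mul_assoc _ (Roast.highDFT N W),
      Roast.highDFT_isometry hN hW, Matrix.one_mul, hU]
  refine ⟨Roast.basis_isometry hN hW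
    (Roast.conjTranspose_submatrix_mul_self hU (Fin.castLE_injective hr)), ?_⟩
  set r := min (Roast.numR N ε) (Roast.numHigh N W) with hr_def
  -- Since `G` has orthonormal columns, the squared residual is the sum of the squared coefficients
  -- of e_f along the discarded columns.
  have hres : ∀ f : ℝ, Roast.norm2 (Roast.sinusoid N f -
      (Roast.basis N W (U.submatrix id (Fin.castLE hr)) *
        (Roast.basis N W (U.submatrix id (Fin.castLE hr)))ᴴ) *ᵥ Roast.sinusoid N f) ^ 2 =
      ∑ i : Fin (Roast.numHigh N W), if r ≤ (i : ℕ) then ‖(Gᴴ *ᵥ Roast.sinusoid N f) i‖ ^ 2 else 0 := by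
    intro f
    have h1 := Roast.one_sub_basis_mul hN hW hU' hr
    rw [Roast.norm2_sq]
    nth_rewrite 1 [← Matrix.one_mulVec (Roast.sinusoid N f)]
    rw [← Matrix.sub_mulVec, h1, ← Matrix.mulVec_mulVec, Roast.sum_norm_sq_mulVec hGG,
      ← Matrix.mulVec_mulVec]
    refine Finset.sum_congr rfl fun i _ => ?_
    rw [Matrix.mulVec_diagonal]
    split_ifs <;> simp [hG]
  have hcont : ∀ i : Fin (Roast.numHigh N W), Continuous fun f =>
      if r ≤ (i : ℕ) then ‖(Gᴴ *ᵥ Roast.sinusoid N f) i‖ ^ 2 else 0 := by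
    intro i
    split_ifs
    · exact (Roast.star_dotProduct_sinusoid_continuous fun n => G n i).norm.pow 2
    · exact continuous_const
  simp_rw [hres, Roast.norm2_sinusoid_sq]
  rw [intervalIntegral.integral_div, div_le_iff₀ hN', mul_comm ε,
    intervalIntegral.integral_finsetSum fun i _ => (hcont i).intervalIntegrable _ _]
  refine le_trans (Finset.sum_le_sum fun i _ => ?_) (Roast.sum_singularValue_le hN hW hA hε.1)
  split_ifs
  · exact Roast.integral_norm_sq_leftSingular_le hN hW hA i
  · simp
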